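/- Let power beacons be located at the points $\{x_k\}_{k\ge 1}$ of a homogeneous Poisson point process of intensity $\lambda>0$ in $\mathbb{R}^2$. Let the fading gains $(H_k)_{k\ge1}$ be i.i.d. $\exp(1)$ and independent of the point process, and let the path loss be $\ell(r,\eta)=\max(1,r^\eta)$ with $\eta>2$. An energy harvester at the origin harvests in each of $m\ge 1$ slots the same energy $$Z=P_{\rm PB}\,\mu\sum_k \frac{H_k}{\ell(\|x_k\|,\eta)},\qquad P_{\rm PB},\mu>0 ,$$ and wants to transmit i.i.d. symbols $X_1,\dots,X_n\sim\mathcal N(0,P_{\rm t})$ with $P_{\rm t}>0$, independent of the beacons and of the fading, where $n$ is even. Put $$a=\frac{P_{\rm t}}{\mu P_{\rm PB}},\qquad s=\frac{m}{2a}.$$ For $k\ge0$ and $x>0$ let $$F_k(x,\eta)=\frac{2x}{\eta-2}\;{}_2F_1\!\left(k+1,\,k+1-\tfrac2\eta;\,k+2-\tfrac2\eta;\,-x\right),\qquad \mathcal F=F_0,$$ $$\Upsilon(k,\eta)=(-1)^k\,k!\,\frac{(1-2/\eta)_{(k)}}{(2-2/\eta)_{(k)}},\qquad (y)_{(k)}=\frac{\Gamma(y+k)}{\Gamma(y)},$$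 where ${}_2F_1$ is the Gauss hypergeometric function, analytically continued to $(-\infty,1)$. Then the energy supply probability $P_{\rm es}^{\rm MP}(m,n,a,\lambda,\eta)=\Pr\left[\sum_{i=1}^n X_i^2\le mZ\right]$ is $$P_{\rm es}^{\rm MP}(m,n,a,\lambda,\eta)=1-e^{-\pi\lambda\left(\frac{s}{1+s}+\mathcal F(s,\eta)\right)}\sum_{i=0}^{\frac n2-1}\frac{(-s)^i}{i!}\,B_i\!\left(g^{(1)}(s),\dots,g^{(i)}(s)\right),$$ where $B_i$ is the $i$-th (exponential) complete Bell polynomial, $B_0=1$, and for $i\ge1$ and $x>0$ $$g^{(i)}(x)=-\pi\lambda\left(\left[-\frac1{1+x}\right]^{i+1} i!+\frac{i}{x}\,\Upsilon(i-1,\eta)\,F_{i-1}(x,\eta)+\Upsilon(i,\eta)\,F_i(x,\eta)\right).$$ Moreover, the function $g(x)=-\pi\lambda\left(\frac{x}{1+x}+\mathcal F(x,\eta)\right)$ is smooth on $(0,\infty)$ and $g^{(i)}(x)$ as displayed is its $i$-th derivative for every $i\ge1$, and for every $k\ge0$ and $x>0$ $$\frac{\mathrm d^k}{\mathrm dx^k}\,{}_2F_1\!\left(1,1-\tfrac2\eta;2-\tfrac2\eta;-x\right)=\Upsilon(k,\eta)\;{}_2F_1\!\left(k+1,k+1-\tfrac2\eta;k+2-\tfrac2\eta;-x\right).$$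 -/

import Mathlib

open MeasureTheory ProbabilityTheory
open scoped ENNReal

noncomputable section

namespace EnergyHarvesting

/-! ### Special functions -/

/-- `f` is an analytic continuation to `(-∞, 1)` of the sum of the Gauss hypergeometric series,
which converges on `(-1, 1)`. -/
def IsHypergeometricContinuation (a b c : ℝ) (f : ℝ → ℝ) : Prop :=
  AnalyticOnNhd ℝ f (Set.Iio 1) ∧
    ∀ z ∈ Set.Ioo (-1 : ℝ) 1, f z = ordinaryHypergeometric a b c z

theorem IsHypergeometricContinuation.eqOn {a b c : ℝ} {f g : ℝ → ℝ}
    (hf : IsHypergeometricContinuation a b c f) (hg : IsHypergeometricContinuation a b c g) :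
    Set.EqOn f g (Set.Iio 1) := by
  refine hf.1.eqOn_of_preconnected_of_eventuallyEq hg.1 isPreconnected_Iio
    (z₀ := 0) (by simp) ?_
  filter_upwards [Ioo_mem_nhds (show (-1 : ℝ) < 0 by norm_num) one_pos] with z hz
  rw [hf.2 z hz, hg.2 z hz]

open Classical in
/-- The Gauss hypergeometric function `₂F₁(a, b; c; ·)` on `(-∞, 1)`: the analytic continuation of
the hypergeometric series (Mathlib's `ordinaryHypergeometric` is only the sum of the series, with a
default value outside of the disc of convergence). -/
def gaussHypergeometric (a b c : ℝ) : ℝ → ℝ :=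
  if h : ∃ f, IsHypergeometricContinuation a b c f then h.choose else 0

/-- Every analytic continuation of the series computes `gaussHypergeometric` on `(-∞, 1)`. -/
theorem gaussHypergeometric_eqOn {a b c : ℝ} {f : ℝ → ℝ}
    (hf : IsHypergeometricContinuation a b c f) :
    Set.EqOn (gaussHypergeometric a b c) f (Set.Iio 1) := by
  have h : ∃ f, IsHypergeometricContinuation a b c f := ⟨f, hf⟩
  rw [gaussHypergeometric, dif_pos h]
  exact h.choose_spec.eqOn hf

/-- The Pochhammer symbol `(x)_(k) = Γ(x + k) / Γ(x)`. -/
def pochhammerSymbol (x : ℝ) (k : ℕ) : ℝ := Real.Gamma (x + k) / Real.Gamma x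

/-- The (exponential) complete Bell polynomial `B_n(u 1, …, u n)`: the sum over all partitions of an
`n`-element set of the product over the blocks of `u (size of the block)`. Elements of
`OrderedFinpartition n` are exactly the partitions of `Fin n` into nonempty blocks, each of them
listed once (the blocks come in a canonical order); `B_0 = 1`. -/
def completeBell (n : ℕ) (u : ℕ → ℝ) : ℝ :=
  ∑ c : OrderedFinpartition n, ∏ j : Fin c.length, u (c.partSize j)

/-- `F_k(x, η) = 2x/(η-2) · ₂F₁(k+1, k+1-2/η; k+2-2/η; -x)`. -/
def hypF (k : ℕ) (x η : ℝ) : ℝ :=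
  2 * x / (η - 2) * gaussHypergeometric (k + 1) (k + 1 - 2 / η) (k + 2 - 2 / η) (-x)

/-- `Υ(i, η) = (-1)^i i! (1-2/η)_(i) / (2-2/η)_(i)`. -/
def upsilon (i : ℕ) (η : ℝ) : ℝ :=
  (-1) ^ i * (i.factorial : ℝ) *
    (pochhammerSymbol (1 - 2 / η) i / pochhammerSymbol (2 - 2 / η) i)

/-- `g(x) = -πλ (x/(1+x) + F_0(x, η))`. -/
def logLaplace (lam η : ℝ) (x : ℝ) : ℝ :=
  -(Real.pi * lam) * (x / (1 + x) + hypF 0 x η)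

/-- The explicit expression for the `i`-th derivative of `g` at `x`, for `i ≥ 1`. -/
def logLaplaceDeriv (lam η : ℝ) (i : ℕ) (x : ℝ) : ℝ :=
  -(Real.pi * lam) *
    ((-(1 / (1 + x))) ^ (i + 1) * (i.factorial : ℝ)
      + (i : ℝ) / x * upsilon (i - 1) η * hypF (i - 1) x η
      + upsilon i η * hypF i x η)

/-! ### The network model -/

/-- The Euclidean plane. -/
abbrev Plane : Type := EuclideanSpace ℝ (Fin 2)

variable {Ω : Type*} [MeasurableSpace Ω]

/-- The number of points of the point process `{x k}` that lie in `A`. -/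
def pointCount (x : ℕ → Ω → Plane) (A : Set Plane) (ω : Ω) : ℕ∞ :=
  {k : ℕ | x k ω ∈ A}.encard

/-- `{x k}` is (an enumeration of the points of) a homogeneous Poisson point process of intensity
`lam` on the plane: the number of points in a bounded Borel set is Poisson distributed with mean
`lam` times the area, and the numbers of points in disjoint bounded Borel sets are independent. -/
structure IsHomogeneousPPP (P : Measure Ω) (lam : ℝ) (x : ℕ → Ω → Plane) : Prop where
  measurable : ∀ k, Measurable (x k)
  hasLaw : ∀ A : Set Plane, MeasurableSet A → Bornology.IsBounded A →
    HasLaw (pointCount x A)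
      ((poissonMeasure (lam * volume.real A).toNNReal).map (Nat.cast : ℕ → ℕ∞)) P
  indep : ∀ (r : ℕ) (A : Fin r → Set Plane), (∀ i, MeasurableSet (A i)) →
    (∀ i, Bornology.IsBounded (A i)) → Pairwise (fun i j => Disjoint (A i) (A j)) →
    iIndepFun (fun i => pointCount x (A i)) P

/-- The bounded path loss `ℓ(r, η) = max(1, r^η)`. -/
def pathLoss (r η : ℝ) : ℝ := max 1 (r ^ η)

/-- The energy `Z = P_PB μ ∑ₖ H_k / ℓ(‖x_k‖, η)` harvested in a channel use by the node at the
origin, as an extended nonnegative real. -/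
def harvestedEnergy (PPB mu η : ℝ) (x : ℕ → Ω → Plane) (H : ℕ → Ω → ℝ) (ω : Ω) : ℝ≥0∞ :=
  ENNReal.ofReal (PPB * mu) * ∑' k, ENNReal.ofReal (H k ω / pathLoss ‖x k ω‖ η)

/-- The energy supply probability `Pr[∑ X_i² ≤ m Z]`. -/
def energySupplyProb (P : Measure Ω) (m : ℕ) {n : ℕ} (X : Fin n → Ω → ℝ) (Z : Ω → ℝ≥0∞) : ℝ :=
  P.real {ω | ENNReal.ofReal (∑ i, X i ω ^ 2) ≤ (m : ℝ≥0∞) * Z ω}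

/-- The random elements of the network with several power beacons: the beacons `x k` form a
homogeneous Poisson point process of intensity `lam`; the fading gains `H k` are i.i.d. `exp(1)` and
independent of the beacons; the intended transmit symbols `X i` are i.i.d. `N(0, Pt)` and
independent of the beacons and of the fading. -/
structure IsMultiBeaconNetwork (P : Measure Ω) (lam Pt : ℝ) {n : ℕ}
    (x : ℕ → Ω → Plane) (H : ℕ → Ω → ℝ) (X : Fin n → Ω → ℝ) : Prop where
  ppp : IsHomogeneousPPP P lam x
  measurable_H : ∀ k, Measurable (H k)
  hasLaw_H : ∀ k, HasLaw (H k) (expMeasure 1) P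
  indep_H : iIndepFun H P
  indep_x_H : IndepFun (fun ω k => x k ω) (fun ω k => H k ω) P
  measurable_X : ∀ i, Measurable (X i)
  hasLaw_X : ∀ i, HasLaw (X i) (gaussianReal 0 Pt.toNNReal) P
  indep_X : iIndepFun X P
  indep_X_xH : IndepFun (fun ω i => X i ω) (fun ω => ((fun k => x k ω), (fun k => H k ω))) P

end EnergyHarvesting

end

namespace EnergyHarvesting

/-! ### An integral representation of the hypergeometric functions -/

/-! Supply fails when `m Z` is below the sum of squares. For `n = 2k` Gaussians that sum has an
Erlang law, so its tail is a finite Poisson sum. With `S = ∑ H_k / ℓ(‖x_k‖)` the normalised shot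
noise, conditioning on `S` makes the failure probability the mean of `e^(-sS) ∑_{i<k} (sS)^i / i!`.
Since `E[(-S)^i e^(-sS)]` is the `i`-th derivative at `s` of the Laplace transform `L` of `S`, this
equals `∑_{i<k} (-s)^i / i! · L^(i)(s)` (`measureReal_lt_of_erlang_tail`).

Next, `L = exp g`. Averaging over exponential fading turns each beacon into a factor `1 / (1 +
t/ℓ)`, and the Laplace functional of the Poisson process (`IsHomogeneousPPP.lintegral_expNeg_tsum`)
gives `g(t) = -λ ∫ t / (t + ℓ(‖y‖)) dy`. In polar coordinates the unit disc contributes `t/(1+t)`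
and its exterior the hypergeometric term, both times `π`. Faà di Bruno's formula for `exp ∘ g` then
produces the Bell polynomials.

All hypergeometric facts come from `I_k(z) = ∫_1^∞ r / (r^η - z)^(k+1) dr`. Expanding the integrand
(`hasSum_resolventIntegral`) yields analyticity on `z < 1`, the rule `I_k' = (k+1) I_(k+1)`, and, at
`z = 0`, the Gauss series up to a constant factor.

Finiteness of `S` is never proved: `S` takes values in `[0, ∞]` and `e^(-∞) = 0`, so the event `S =
∞` contributes nothing to `L` or to failure. -/

/-- The integral `∫_1^∞ r / (r^η - z)^(k+1) dr`, a multiple of `₂F₁(k+1, k+1-2/η; k+2-2/η; z)`. -/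
noncomputable def resolventIntegral (η : ℝ) (k : ℕ) (z : ℝ) : ℝ :=
  ∫ r in Set.Ioi (1 : ℝ), r / (r ^ η - z) ^ (k + 1)

section

variable {η : ℝ} {z : ℝ}

theorem one_sub_lt_rpow_sub (hη : 2 < η) (z : ℝ) {r : ℝ} (hr : r ∈ Set.Ioi (1 : ℝ)) :
    1 - z < r ^ η - z :=
  sub_lt_sub_right (Real.one_lt_rpow hr (by linarith)) z

theorem measurable_resolvent (η : ℝ) (k : ℕ) (z : ℝ) :
    Measurable fun r : ℝ => r / (r ^ η - z) ^ (k + 1) := by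
  fun_prop

theorem integrableOn_resolvent_zero (hη : 2 < η) (hz : z < 1) :
    IntegrableOn (fun r : ℝ => r / (r ^ η - z)) (Set.Ioi 1) := by
  -- This `δ` makes `δ r^η ≤ r^η - z` for all `r > 1`: for `z ≤ 0` it is `1`, and otherwise the
  -- difference is `z (r^η - 1)`. The integrand is then dominated by `r^(1-η)`.
  set δ : ℝ := min 1 (1 - z)
  have hδ : 0 < δ := lt_min one_pos (by linarith)
  have hδ1 : δ ≤ 1 := min_le_left _ _
  have hδz : δ ≤ 1 - z := min_le_right _ _
  refine Integrable.mono' ((integrableOn_Ioi_rpow_of_lt (show 1 - η < -1 by linarith)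
    one_pos).const_mul δ⁻¹) (Measurable.aestronglyMeasurable (by fun_prop)) ?_
  filter_upwards [ae_restrict_mem measurableSet_Ioi] with r hr
  have hr0 : 0 < r := one_pos.trans hr
  have h1 := Real.one_lt_rpow hr (show 0 < η by linarith)
  have hle : δ * r ^ η ≤ r ^ η - z := by nlinarith
  have hpos : 0 < r ^ η := one_pos.trans h1
  rw [Real.norm_of_nonneg (div_nonneg hr0.le ((mul_pos hδ hpos).le.trans hle))]
  calc r / (r ^ η - z) ≤ r / (δ * r ^ η) := by gcongr
    _ = δ⁻¹ * r ^ (1 - η) := by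
      rw [Real.rpow_sub hr0, Real.rpow_one]
      field_simp

theorem resolvent_le (hη : 2 < η) (hz : z < 1) (k : ℕ) {r : ℝ} (hr : r ∈ Set.Ioi (1 : ℝ)) :
    r / (r ^ η - z) ^ (k + 1) ≤ ((1 - z)⁻¹) ^ k * (r / (r ^ η - z)) := by
  have hr0 : 0 < r := one_pos.trans hr
  have h1 := one_sub_lt_rpow_sub hη z hr
  have h2 : 0 < 1 - z := by linarith
  have h3 : 0 < r ^ η - z := h2.trans h1
  calc r / (r ^ η - z) ^ (k + 1) = ((r ^ η - z)⁻¹) ^ k * (r / (r ^ η - z)) := by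
        rw [pow_succ, inv_pow]; field_simp
    _ ≤ _ := by gcongr

theorem resolvent_nonneg (hη : 2 < η) (hz : z < 1) (k : ℕ) {r : ℝ} (hr : r ∈ Set.Ioi (1 : ℝ)) :
    0 ≤ r / (r ^ η - z) ^ (k + 1) := by
  have hr0 : 0 < r := one_pos.trans hr
  have h1 := one_sub_lt_rpow_sub hη z hr
  exact div_nonneg hr0.le (pow_nonneg (by linarith) _)

theorem integrableOn_resolvent (hη : 2 < η) (hz : z < 1) (k : ℕ) :
    IntegrableOn (fun r : ℝ => r / (r ^ η - z) ^ (k + 1)) (Set.Ioi 1) := by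
  refine Integrable.mono' ((integrableOn_resolvent_zero hη hz).const_mul (((1 - z)⁻¹) ^ k))
    (measurable_resolvent η k z).aestronglyMeasurable ?_
  filter_upwards [ae_restrict_mem measurableSet_Ioi] with r hr
  rw [Real.norm_of_nonneg (resolvent_nonneg hη hz k hr)]
  exact resolvent_le hη hz k hr

theorem resolventIntegral_nonneg (hη : 2 < η) (hz : z < 1) (k : ℕ) :
    0 ≤ resolventIntegral η k z :=
  setIntegral_nonneg measurableSet_Ioi fun _ hr => resolvent_nonneg hη hz k hr

theorem resolventIntegral_le (hη : 2 < η) (hz : z < 1) (k : ℕ) :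
    resolventIntegral η k z ≤ ((1 - z)⁻¹) ^ k * ∫ r in Set.Ioi (1 : ℝ), r / (r ^ η - z) := by
  rw [resolventIntegral, ← integral_const_mul]
  exact setIntegral_mono_on (integrableOn_resolvent hη hz k)
    ((integrableOn_resolvent_zero hη hz).const_mul _) measurableSet_Ioi
    fun r hr => resolvent_le hη hz k hr

/-- The Taylor expansion of `resolventIntegral η k` at `z < 1`. -/
theorem hasSum_resolventIntegral (hη : 2 < η) (hz : z < 1) (k : ℕ) {w : ℝ} (hw : |w| < 1 - z) :
    HasSum (fun n : ℕ => w ^ n * (((n + k).choose k : ℝ) * resolventIntegral η (n + k) z))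
      (resolventIntegral η k (z + w)) := by
  have h2 : 0 < 1 - z := by linarith
  let F : ℕ → ℝ → ℝ := fun n r =>
    w ^ n * (((n + k).choose k : ℝ) * (r / (r ^ η - z) ^ (n + k + 1)))
  have hint : ∀ n, Integrable (F n) (volume.restrict (Set.Ioi 1)) := fun n =>
    ((integrableOn_resolvent hη hz (n + k)).const_mul _).const_mul _
  have hnorm : ∀ n, ∫ r in Set.Ioi (1 : ℝ), ‖F n r‖
      = |w| ^ n * (((n + k).choose k : ℝ) * resolventIntegral η (n + k) z) := by
    intro n
    rw [resolventIntegral, ← integral_const_mul, ← integral_const_mul]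
    refine setIntegral_congr_fun measurableSet_Ioi fun r hr => ?_
    simp only [F, norm_mul, norm_pow, Real.norm_eq_abs, Nat.abs_cast]
    rw [abs_of_nonneg (resolvent_nonneg hη hz (n + k) hr)]
  have hq : ‖|w| * (1 - z)⁻¹‖ < 1 := by
    rw [Real.norm_of_nonneg (by positivity), ← div_eq_mul_inv, div_lt_one h2]
    exact hw
  -- Each extra power of the denominator costs at most `(1 - z)⁻¹`, so the norms are dominated by a
  -- negative binomial series of ratio `|w| / (1 - z) < 1`.
  have hsum : Summable fun n => ∫ r in Set.Ioi (1 : ℝ), ‖F n r‖ := by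
    simp_rw [hnorm]
    refine Summable.of_nonneg_of_le (fun n => ?_) (fun n => ?_)
      ((hasSum_choose_mul_geometric_of_norm_lt_one k hq).summable.mul_right
        (((1 - z)⁻¹) ^ k * ∫ r in Set.Ioi (1 : ℝ), r / (r ^ η - z)))
    · exact mul_nonneg (by positivity)
        (mul_nonneg (by positivity) (resolventIntegral_nonneg hη hz _))
    · calc |w| ^ n * (((n + k).choose k : ℝ) * resolventIntegral η (n + k) z)
          ≤ |w| ^ n * (((n + k).choose k : ℝ) *
            (((1 - z)⁻¹) ^ (n + k) * ∫ r in Set.Ioi (1 : ℝ), r / (r ^ η - z))) := by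
            gcongr
            exact resolventIntegral_le hη hz _
        _ = _ := by rw [mul_pow, pow_add]; ring
  have key := hasSum_integral_of_summable_integral_norm hint hsum
  convert! key using 1
  · funext n
    simp only [F]
    rw [integral_const_mul, integral_const_mul, resolventIntegral]
  -- Pointwise this is the negative binomial series in `w / (r^η - z)`.
  · refine setIntegral_congr_fun measurableSet_Ioi fun r hr => ?_
    have h1 := one_sub_lt_rpow_sub hη z hr
    have h3 : 0 < r ^ η - z := h2.trans h1
    have hq' : ‖w / (r ^ η - z)‖ < 1 := by
      rw [norm_div, Real.norm_of_nonneg h3.le, div_lt_one h3]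
      exact hw.trans h1
    have hs := (hasSum_choose_mul_geometric_of_norm_lt_one k hq').mul_right
      (r / (r ^ η - z) ^ (k + 1))
    have h4 : r ^ η - (z + w) ≠ 0 := by
      have := le_abs_self w
      linarith
    have heq : 1 / (1 - w / (r ^ η - z)) ^ (k + 1) * (r / (r ^ η - z) ^ (k + 1))
        = r / (r ^ η - (z + w)) ^ (k + 1) := by
      rw [one_sub_div h3.ne', div_pow, sub_sub]
      have := pow_ne_zero (k + 1) h3.ne'
      have := pow_ne_zero (k + 1) h4
      field_simp
    rw [heq] at hs
    rw [← hs.tsum_eq]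
    refine tsum_congr fun n => ?_
    simp only [F]
    rw [div_pow, show n + k + 1 = n + (k + 1) by ring, pow_add]
    field_simp
    ring

theorem hasFPowerSeriesAt_resolventIntegral (hη : 2 < η) (hz : z < 1) (k : ℕ) :
    HasFPowerSeriesAt (resolventIntegral η k)
      (FormalMultilinearSeries.ofScalars ℝ
        fun n : ℕ => ((n + k).choose k : ℝ) * resolventIntegral η (n + k) z) z := by
  rw [hasFPowerSeriesAt_iff]
  filter_upwards [Metric.ball_mem_nhds (0 : ℝ) (show 0 < 1 - z by linarith)] with w hw
  have hw' : |w| < 1 - z := by simpa using hw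
  simpa [FormalMultilinearSeries.coeff_ofScalars] using hasSum_resolventIntegral hη hz k hw'

theorem analyticOnNhd_resolventIntegral (hη : 2 < η) (k : ℕ) :
    AnalyticOnNhd ℝ (resolventIntegral η k) (Set.Iio 1) := fun _ hz =>
  (hasFPowerSeriesAt_resolventIntegral hη hz k).analyticAt

theorem hasDerivAt_resolventIntegral (hη : 2 < η) (hz : z < 1) (k : ℕ) :
    HasDerivAt (resolventIntegral η k) ((k + 1 : ℝ) * resolventIntegral η (k + 1) z) z := by
  have h := (hasFPowerSeriesAt_resolventIntegral hη hz k).hasDerivAt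
  simpa [FormalMultilinearSeries.ofScalars_apply_eq, add_comm] using h

theorem iteratedDeriv_resolventIntegral (hη : 2 < η) (k : ℕ) (hz : z < 1) :
    iteratedDeriv k (resolventIntegral η 0) z = (k.factorial : ℝ) * resolventIntegral η k z := by
  induction k generalizing z with
  | zero => simp
  | succ k ih =>
    have hev : iteratedDeriv k (resolventIntegral η 0) =ᶠ[nhds z]
        fun y => (k.factorial : ℝ) * resolventIntegral η k y := by
      filter_upwards [Iio_mem_nhds hz] with y hy using ih hy
    rw [iteratedDeriv_succ, hev.deriv_eq,
      ((hasDerivAt_resolventIntegral hη hz k).const_mul _).deriv, Nat.factorial_succ]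
    push_cast
    ring

theorem resolventIntegral_at_zero (hη : 2 < η) (k : ℕ) :
    resolventIntegral η k 0 = 1 / (η * (k + 1) - 2) := by
  have hk : (0 : ℝ) ≤ k := k.cast_nonneg
  have : ∀ r ∈ Set.Ioi (1 : ℝ), r / (r ^ η - 0) ^ (k + 1) = r ^ (1 - η * (k + 1)) := by
    intro r hr
    have hr0 : 0 < r := one_pos.trans hr
    rw [sub_zero, Real.rpow_sub hr0, Real.rpow_one, ← Real.rpow_natCast, ← Real.rpow_mul hr0.le]
    push_cast
    rfl
  rw [resolventIntegral, setIntegral_congr_fun measurableSet_Ioi this,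
    integral_Ioi_rpow_of_lt (by nlinarith) one_pos, Real.one_rpow, ← neg_div_neg_eq, neg_neg]
  congr 1
  ring

/-! ### Matching the Gauss series and the constants `Υ` -/

theorem ascPochhammer_eval_div_succ {c : ℝ} (hc : 0 < c) (n : ℕ) :
    (ascPochhammer ℝ n).eval c * ((ascPochhammer ℝ n).eval (c + 1))⁻¹ = c / (c + n) := by
  induction n with
  | zero => simp [hc.ne']
  | succ n ih =>
    have hn : (0 : ℝ) ≤ n := n.cast_nonneg
    rw [ascPochhammer_succ_eval, ascPochhammer_succ_eval, mul_inv, mul_mul_mul_comm, ih]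
    push_cast
    have h1 : c + n ≠ 0 := by positivity
    have h2 : c + 1 + n ≠ 0 := by positivity
    have h3 : c + (n + 1) ≠ 0 := by positivity
    field_simp
    ring

/-- The last two parameters differ by one, so their Pochhammer quotient telescopes to `b / (b + n)`,
which is proportional to `I_(n+k)(0)`. The remaining factor `(k+1)_n / n!` is the binomial
coefficient of the Taylor expansion at `0`. -/
theorem isHypergeometricContinuation_resolventIntegral (hη : 2 < η) (k : ℕ) :
    IsHypergeometricContinuation (k + 1) (k + 1 - 2 / η) (k + 2 - 2 / η)
      (fun z => (η * (k + 1) - 2) * resolventIntegral η k z) := by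
  refine ⟨fun z hz => analyticAt_const.mul (analyticOnNhd_resolventIntegral hη k z hz),
    fun z hz => ?_⟩
  have hk : (0 : ℝ) ≤ k := k.cast_nonneg
  have hη0 : 0 < η := by linarith
  have h := (hasSum_resolventIntegral hη zero_lt_one k (w := z)
    (by rw [sub_zero, abs_lt]; exact hz)).mul_left (η * (k + 1) - 2)
  rw [zero_add] at h
  have hb : (0 : ℝ) < k + 1 - 2 / η := by
    have : 2 / η < 1 := (div_lt_one hη0).2 hη
    linarith
  rw [ordinaryHypergeometric_eq_tsum]
  refine h.tsum_eq.symm.trans ?_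
  refine tsum_congr fun n => ?_
  have hc : (k + 2 - 2 / η : ℝ) = (k + 1 - 2 / η) + 1 := by ring
  have hn : (0 : ℝ) ≤ n := n.cast_nonneg
  have hd : η * (n + k + 1) - 2 ≠ 0 := by nlinarith [mul_nonneg hη0.le hn, mul_nonneg hη0.le hk]
  have hd' : (k + 1 - 2 / η : ℝ) + n ≠ 0 := by positivity
  have hfac : (n.factorial : ℝ) ≠ 0 := by positivity
  have hpoch : (ascPochhammer ℝ n).eval (k + 1 : ℝ)
      = (n.factorial : ℝ) * ((n + k).choose k : ℝ) := by
    have h1 := ascPochhammer_nat_eq_natCast_ascFactorial ℝ (k + 1) n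
    rw [Nat.ascFactorial_eq_factorial_mul_choose, add_comm k n, Nat.choose_symm_add] at h1
    exact_mod_cast h1
  rw [hc, mul_assoc (_ * _), ascPochhammer_eval_div_succ hb, hpoch, resolventIntegral_at_zero hη,
    smul_eq_mul]
  push_cast
  have hfrac : (k + 1 - 2 / η : ℝ) / (k + 1 - 2 / η + n)
      = (η * (k + 1) - 2) * (1 / (η * (n + k + 1) - 2)) := by
    rw [mul_one_div, div_eq_div_iff hd' hd]
    field_simp
    ring
  rw [hfrac]
  field_simp

theorem gaussHypergeometric_eq_resolventIntegral (hη : 2 < η) (k : ℕ) (hz : z < 1) :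
    gaussHypergeometric (k + 1) (k + 1 - 2 / η) (k + 2 - 2 / η) z
      = (η * (k + 1) - 2) * resolventIntegral η k z :=
  gaussHypergeometric_eqOn (isHypergeometricContinuation_resolventIntegral hη k) hz

theorem pochhammerSymbol_div_succ {c : ℝ} (hc : 0 < c) (k : ℕ) :
    pochhammerSymbol c k / pochhammerSymbol (c + 1) k = c / (c + k) := by
  have hk : (0 : ℝ) ≤ k := k.cast_nonneg
  have hck : 0 < c + k := by positivity
  have h1 := (Real.Gamma_pos_of_pos hc).ne'
  have h2 := (Real.Gamma_pos_of_pos hck).ne'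
  rw [pochhammerSymbol, pochhammerSymbol, show c + 1 + k = c + k + 1 by ring,
    Real.Gamma_add_one hc.ne', Real.Gamma_add_one hck.ne']
  field_simp

theorem upsilon_eq (hη : 2 < η) (k : ℕ) :
    upsilon k η = (-1) ^ k * (k.factorial : ℝ) * ((η - 2) / (η * (k + 1) - 2)) := by
  have hk : (0 : ℝ) ≤ k := k.cast_nonneg
  have hη0 : 0 < η := by linarith
  have hb : (0 : ℝ) < 1 - 2 / η := by
    have : 2 / η < 1 := (div_lt_one hη0).2 hη
    linarith
  have hd : η * (k + 1) - 2 ≠ 0 := by nlinarith [mul_nonneg hη0.le hk]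
  have hd' : 1 - 2 / η + k ≠ 0 := by positivity
  rw [upsilon, show 2 - 2 / η = (1 - 2 / η) + 1 by ring, pochhammerSymbol_div_succ hb]
  congr 1
  rw [div_eq_div_iff hd' hd]
  field_simp
  ring

/-- The quotient in `Υ` cancels the `k`-dependent normalisation of `₂F₁` against `I_k`; what remains
is the factor from differentiating `I_0(-t)` `k` times. -/
theorem upsilon_mul_gaussHypergeometric (hη : 2 < η) (k : ℕ) (hz : z < 1) :
    upsilon k η * gaussHypergeometric (k + 1) (k + 1 - 2 / η) (k + 2 - 2 / η) z
      = (-1) ^ k * (k.factorial : ℝ) * (η - 2) * resolventIntegral η k z := by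
  have hk : (0 : ℝ) ≤ k := k.cast_nonneg
  have hd : η * (k + 1) - 2 ≠ 0 := by nlinarith [mul_nonneg (show 0 ≤ η by linarith) hk]
  rw [gaussHypergeometric_eq_resolventIntegral hη k hz, upsilon_eq hη]
  field_simp

theorem iteratedDeriv_resolventIntegral_neg (hη : 2 < η) (k : ℕ) {y : ℝ} (hy : 0 < y) :
    iteratedDeriv k (fun t => (η - 2) * resolventIntegral η 0 (-t)) y
      = (-1) ^ k * (k.factorial : ℝ) * (η - 2) * resolventIntegral η k (-y) := by
  rw [iteratedDeriv_const_mul_field, iteratedDeriv_comp_neg,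
    iteratedDeriv_resolventIntegral hη k (by linarith), smul_eq_mul]
  ring

theorem gaussHypergeometric_neg_eventuallyEq (hη : 2 < η) {y : ℝ} (hy : 0 < y) :
    (fun t => gaussHypergeometric 1 (1 - 2 / η) (2 - 2 / η) (-t)) =ᶠ[nhds y]
      fun t => (η - 2) * resolventIntegral η 0 (-t) := by
  filter_upwards [Ioi_mem_nhds hy] with t ht
  have := gaussHypergeometric_eq_resolventIntegral hη 0 (z := -t)
    (by have : 0 < t := ht; linarith)
  simpa using this

theorem iteratedDeriv_gaussHypergeometric_neg (hη : 2 < η) (k : ℕ) {y : ℝ} (hy : 0 < y) :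
    iteratedDeriv k (fun t => gaussHypergeometric 1 (1 - 2 / η) (2 - 2 / η) (-t)) y =
      upsilon k η * gaussHypergeometric (k + 1) (k + 1 - 2 / η) (k + 2 - 2 / η) (-y) := by
  rw [(gaussHypergeometric_neg_eventuallyEq hη hy).iteratedDeriv_eq,
    iteratedDeriv_resolventIntegral_neg hη k hy,
    upsilon_mul_gaussHypergeometric hη k (by linarith)]

/-! ### The derivatives of the logarithm of the Laplace transform -/

theorem hypF_zero_eq (hη : 2 < η) {y : ℝ} (hy : 0 < y) :
    hypF 0 y η = 2 * y * resolventIntegral η 0 (-y) := by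
  have h := (gaussHypergeometric_neg_eventuallyEq hη hy).eq_of_nhds
  have : η - 2 ≠ 0 := by linarith
  simp only [hypF, Nat.cast_zero, zero_add]
  rw [h]
  field_simp

theorem upsilon_mul_hypF (hη : 2 < η) (k : ℕ) {y : ℝ} (hy : 0 < y) :
    upsilon k η * hypF k y η
      = 2 * y * ((-1) ^ k * (k.factorial : ℝ) * resolventIntegral η k (-y)) := by
  have : η - 2 ≠ 0 := by linarith
  rw [hypF, mul_left_comm, upsilon_mul_gaussHypergeometric hη k (by linarith)]
  field_simp

/-- Derivatives are local, so an identity near each positive point suffices; the form `1 - (t +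
1)⁻¹` is the one convenient to differentiate. -/
theorem logLaplace_eventuallyEq (hη : 2 < η) (lam : ℝ) {y : ℝ} (hy : 0 < y) :
    logLaplace lam η =ᶠ[nhds y]
      fun t => -(Real.pi * lam) * ((1 - (t + 1)⁻¹) + t * (2 * resolventIntegral η 0 (-t))) := by
  filter_upwards [Ioi_mem_nhds hy] with t ht
  have ht0 : 0 < t := ht
  rw [logLaplace, hypF_zero_eq hη ht]
  have : 1 + t ≠ 0 := by positivity
  have : t + 1 ≠ 0 := by positivity
  field_simp
  ring

theorem contDiffAt_resolventIntegral_neg (hη : 2 < η) {y : ℝ} (hy : 0 < y) (n : WithTop ℕ∞) :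
    ContDiffAt ℝ n (fun t => 2 * resolventIntegral η 0 (-t)) y := by
  have h : ContDiffAt ℝ n (resolventIntegral η 0) (-y) :=
    (analyticOnNhd_resolventIntegral hη 0 (-y) (show -y < 1 by linarith)).contDiffAt
  exact contDiffAt_const.mul (h.comp y contDiffAt_id.neg)

theorem contDiffAt_logLaplace (hη : 2 < η) (lam : ℝ) {y : ℝ} (hy : 0 < y) (n : WithTop ℕ∞) :
    ContDiffAt ℝ n (logLaplace lam η) y := by
  refine ContDiffAt.congr_of_eventuallyEq ?_ (logLaplace_eventuallyEq hη lam hy)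
  refine contDiffAt_const.mul (ContDiffAt.add (contDiffAt_const.sub ?_)
    (contDiffAt_id.mul (contDiffAt_resolventIntegral_neg hη hy n)))
  exact (contDiffAt_id.add contDiffAt_const).inv (by simp; positivity)

theorem hasDerivAt_resolventIntegral_neg (hη : 2 < η) {y : ℝ} (hy : 0 < y) (k : ℕ) :
    HasDerivAt (fun t => resolventIntegral η k (-t))
      (-((k + 1 : ℝ) * resolventIntegral η (k + 1) (-y))) y := by
  have h := (hasDerivAt_resolventIntegral hη (show -y < 1 by linarith) k).comp y
    (hasDerivAt_neg y)
  rwa [mul_neg_one] at h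

theorem hasDerivAt_inv_one_add_pow {y : ℝ} (hy : 0 < y) (k : ℕ) :
    HasDerivAt (fun t : ℝ => ((1 + t)⁻¹) ^ k) (-(k * ((1 + y)⁻¹) ^ (k + 1))) y := by
  have hy1 : 1 + y ≠ 0 := by positivity
  have h := (((hasDerivAt_id y).const_add 1).inv hy1).pow k
  refine h.congr_deriv ?_
  rcases k with _ | k
  · simp
  · simp only [Nat.add_sub_cancel, id, Pi.inv_apply, pow_succ]
    field_simp

/-- Leibniz' rule for `t · I_0(-t)` leaves only two terms, as `t` has no second derivative. The
formula starts at order one, where the constant in `1 - (1 + t)⁻¹` is gone. -/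
theorem iteratedDeriv_succ_logLaplace (hη : 2 < η) (lam : ℝ) (j : ℕ) {y : ℝ} (hy : 0 < y) :
    iteratedDeriv (j + 1) (logLaplace lam η) y =
      -(Real.pi * lam) * ((-1) ^ j * ((j + 1).factorial : ℝ) *
        (((1 + y)⁻¹) ^ (j + 2) + 2 * resolventIntegral η j (-y)
          - 2 * y * resolventIntegral η (j + 1) (-y))) := by
  induction j generalizing y with
  | zero =>
    rw [zero_add, iteratedDeriv_one, (logLaplace_eventuallyEq hη lam hy).deriv_eq]
    have h1 := (hasDerivAt_inv_one_add_pow hy 1).const_sub 1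
    have h2 := (hasDerivAt_id y).mul ((hasDerivAt_resolventIntegral_neg hη hy 0).const_mul 2)
    have h := ((h1.add h2).const_mul (-(Real.pi * lam))).deriv
    simp only [pow_one, add_comm (1 : ℝ)] at h
    refine h.trans ?_
    simp only [id, pow_zero, zero_add, Nat.factorial_one]
    push_cast
    ring
  | succ j ih =>
    have hev : iteratedDeriv (j + 1) (logLaplace lam η) =ᶠ[nhds y] fun y =>
        -(Real.pi * lam) * ((-1) ^ j * ((j + 1).factorial : ℝ) *
          (((1 + y)⁻¹) ^ (j + 2) + 2 * resolventIntegral η j (-y)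
            - 2 * y * resolventIntegral η (j + 1) (-y))) := by
      filter_upwards [Ioi_mem_nhds hy] with t ht using ih ht
    rw [iteratedDeriv_succ, hev.deriv_eq]
    have h1 := hasDerivAt_inv_one_add_pow hy (j + 2)
    have h2 := (hasDerivAt_resolventIntegral_neg hη hy j).const_mul 2
    have h3 := ((hasDerivAt_id y).const_mul 2).mul
      (hasDerivAt_resolventIntegral_neg hη hy (j + 1))
    refine (((((h1.add h2).sub h3).const_mul ((-1) ^ j * ((j + 1).factorial : ℝ))).const_mul
      (-(Real.pi * lam))).deriv).trans ?_
    rw [Nat.factorial_succ (j + 1)]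
    simp only [id]
    push_cast
    ring

theorem iteratedDeriv_logLaplace (hη : 2 < η) (lam : ℝ) {y : ℝ} (hy : 0 < y) {i : ℕ}
    (hi : 1 ≤ i) : iteratedDeriv i (logLaplace lam η) y = logLaplaceDeriv lam η i y := by
  obtain ⟨j, rfl⟩ : ∃ j, i = j + 1 := ⟨i - 1, by omega⟩
  rw [iteratedDeriv_succ_logLaplace hη lam j hy, logLaplaceDeriv, Nat.add_sub_cancel,
    mul_assoc (_ / y), upsilon_mul_hypF hη j hy, upsilon_mul_hypF hη (j + 1) hy, neg_pow,
    one_div, Nat.factorial_succ]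
  push_cast
  field_simp
  ring

/-- Faà di Bruno's formula for the exponential of the log-Laplace transform. -/
theorem iteratedDeriv_exp_logLaplace (hη : 2 < η) (lam : ℝ) {y : ℝ} (hy : 0 < y) (i : ℕ) :
    iteratedDeriv i (fun t => Real.exp (logLaplace lam η t)) y =
      Real.exp (logLaplace lam η y) * completeBell i fun j => logLaplaceDeriv lam η j y := by
  have h := iteratedDeriv_comp_eq_sum_orderedFinpartition (g := Real.exp)
    (f := logLaplace lam η) (x := y) (n := i) (i := i) Real.contDiff_exp.contDiffAt
    (contDiffAt_logLaplace hη lam hy _) le_rfl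
  refine h.trans ?_
  rw [completeBell, Finset.mul_sum]
  refine Finset.sum_congr rfl fun c _ => ?_
  rw [iteratedDeriv_eq_iterate, Real.iter_deriv_exp]
  congr 1
  -- Blocks are nonempty, so only derivatives of order at least one occur.
  exact Finset.prod_congr rfl fun j _ =>
    iteratedDeriv_logLaplace hη lam hy (c.partSize_pos j)

end

/-! ### The function `exp (-·)` on the extended nonnegative reals -/

/-- `t ↦ e^(-t)` on `[0, ∞]`, with `e^(-∞) = 0`. -/
noncomputable def expNeg (t : ℝ≥0∞) : ℝ≥0∞ := EReal.exp (-(t : EReal))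

@[simp] theorem expNeg_zero : expNeg 0 = 1 := by simp [expNeg]

@[simp] theorem expNeg_top : expNeg ∞ = 0 := by simp [expNeg]

theorem continuous_expNeg : Continuous expNeg :=
  ENNReal.continuous_exp.comp (continuous_neg.comp continuous_coe_ennreal_ereal)

theorem measurable_expNeg : Measurable expNeg := continuous_expNeg.measurable

theorem antitone_expNeg : Antitone expNeg := fun _ _ h =>
  EReal.exp_monotone (EReal.neg_le_neg_iff.2 (EReal.coe_ennreal_le_coe_ennreal_iff.2 h))

theorem expNeg_le_one (t : ℝ≥0∞) : expNeg t ≤ 1 := expNeg_zero ▸ antitone_expNeg zero_le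

theorem expNeg_ne_top (t : ℝ≥0∞) : expNeg t ≠ ∞ := ((expNeg_le_one t).trans_lt ENNReal.one_lt_top).ne

theorem expNeg_ofReal {x : ℝ} (hx : 0 ≤ x) :
    expNeg (ENNReal.ofReal x) = ENNReal.ofReal (Real.exp (-x)) := by
  rw [expNeg, EReal.coe_ennreal_ofReal, max_eq_left hx, ← EReal.coe_neg, EReal.exp_coe]

theorem expNeg_add (a b : ℝ≥0∞) : expNeg (a + b) = expNeg a * expNeg b := by
  rw [expNeg, EReal.coe_ennreal_add, EReal.neg_add (by simp) (by simp), sub_eq_add_neg,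
    EReal.exp_add, expNeg, expNeg]

theorem expNeg_sum {ι : Type*} (s : Finset ι) (f : ι → ℝ≥0∞) :
    expNeg (∑ i ∈ s, f i) = ∏ i ∈ s, expNeg (f i) := by
  classical
  induction s using Finset.induction_on with
  | empty => simp
  | insert i s hi ih => rw [Finset.sum_insert hi, Finset.prod_insert hi, expNeg_add, ih]

theorem expNeg_natCast_mul (n : ℕ) (c : ℝ≥0∞) : expNeg (n * c) = expNeg c ^ n := by
  have := expNeg_sum (Finset.range n) fun _ => c
  simpa using this

theorem tendsto_expNeg_sum_range (f : ℕ → ℝ≥0∞) :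
    Filter.Tendsto (fun n => ∏ i ∈ Finset.range n, expNeg (f i)) Filter.atTop
      (nhds (expNeg (∑' i, f i))) := by
  simp_rw [← expNeg_sum]
  exact (continuous_expNeg.tendsto _).comp (ENNReal.tendsto_nat_tsum f)

/-- The bound `e^(-t) ≤ 1` supplies a dominating function on a finite measure space. -/
theorem tendsto_lintegral_expNeg {α : Type*} [MeasurableSpace α] {μ : Measure α}
    [IsFiniteMeasure μ] {F : ℕ → α → ℝ≥0∞} {f : α → ℝ≥0∞} (hF : ∀ n, Measurable (F n))
    (h : ∀ a, Filter.Tendsto (fun n => F n a) Filter.atTop (nhds (f a))) :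
    Filter.Tendsto (fun n => ∫⁻ a, expNeg (F n a) ∂μ) Filter.atTop
      (nhds (∫⁻ a, expNeg (f a) ∂μ)) :=
  tendsto_lintegral_of_dominated_convergence (fun _ => 1)
    (fun n => measurable_expNeg.comp (hF n)) (fun _ => ae_of_all _ fun _ => expNeg_le_one _)
    (by simp) (ae_of_all _ fun a => (continuous_expNeg.tendsto _).comp (h a))

/-! ### The Laplace functional of a Poisson point process -/

/-- This is the generating function `E q^N = e^(-r(1-q))` at `q = e^(-c)`, with `c = ∞`, `q = 0`
allowed. -/
theorem lintegral_expNeg_poissonMeasure (r : NNReal) (c : ℝ≥0∞) :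
    ∫⁻ n : ℕ, expNeg (n * c) ∂(poissonMeasure r) = expNeg (r * (1 - expNeg c)) := by
  obtain ⟨q, hq⟩ : ∃ q : NNReal, expNeg c = q :=
    ⟨_, (ENNReal.coe_toNNReal (expNeg_ne_top c)).symm⟩
  have hq1 : q ≤ 1 := by exact_mod_cast hq ▸ expNeg_le_one c
  have hq1' : (q : ℝ) ≤ 1 := by exact_mod_cast hq1
  rw [lintegral_countable']
  have hterm : ∀ n : ℕ, expNeg (n * c) * poissonMeasure r {n}
      = ENNReal.ofReal (Real.exp (-r) * ((n.factorial : ℝ)⁻¹ * ((q : ℝ) * r) ^ n)) := by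
    intro n
    rw [expNeg_natCast_mul, hq, poissonMeasure_singleton, ← ENNReal.ofReal_coe_nnreal,
      ← ENNReal.ofReal_pow q.coe_nonneg, ← ENNReal.ofReal_mul (by positivity)]
    congr 1
    rw [mul_pow]
    ring
  have hsum : HasSum (fun n : ℕ => Real.exp (-r) * ((n.factorial : ℝ)⁻¹ * ((q : ℝ) * r) ^ n))
      (Real.exp (-r) * Real.exp (q * r)) := by
    have := NormedSpace.exp_series_hasSum_exp' (𝕂 := ℝ) ((q : ℝ) * r)
    rw [← Real.exp_eq_exp_ℝ] at this
    simpa using this.mul_left (Real.exp (-r))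
  rw [tsum_congr hterm, ← ENNReal.ofReal_tsum_of_nonneg (fun n => by positivity) hsum.summable,
    hsum.tsum_eq, hq]
  have : (r : ℝ≥0∞) * (1 - (q : ℝ≥0∞)) = ENNReal.ofReal (r * (1 - q)) := by
    rw [ENNReal.ofReal_mul r.coe_nonneg, ENNReal.ofReal_sub _ q.coe_nonneg]
    simp
  rw [this, expNeg_ofReal (mul_nonneg r.coe_nonneg (by linarith)), ← Real.exp_add]
  congr 2
  ring

theorem tsum_indicator_const_eq {Ω : Type*} (x : ℕ → Ω → Plane) (A : Set Plane) (c : ℝ≥0∞) (ω : Ω) :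
    ∑' k, A.indicator (fun _ => c) (x k ω) = (pointCount x A ω : ℝ≥0∞) * c := by
  rw [pointCount, ← ENNReal.tsum_set_const, tsum_subtype _ fun _ => c]
  rfl

section PoissonPointProcess

variable {Ω : Type*} [MeasurableSpace Ω] {P : Measure Ω} {lam : ℝ} {x : ℕ → Ω → Plane}

theorem IsHomogeneousPPP.measurable_pointCount (h : IsHomogeneousPPP P lam x) {A : Set Plane}
    (hA : MeasurableSet A) : Measurable fun ω => (pointCount x A ω : ℝ≥0∞) := by
  have : (fun ω => (pointCount x A ω : ℝ≥0∞))
      = fun ω => ∑' k, A.indicator (fun _ => (1 : ℝ≥0∞)) (x k ω) := by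
    funext ω
    rw [tsum_indicator_const_eq, mul_one]
  rw [this]
  exact Measurable.tsum fun k => (measurable_const.indicator hA).comp (h.measurable k)

theorem IsHomogeneousPPP.lintegral_expNeg_pointCount (h : IsHomogeneousPPP P lam x)
    (hlam : 0 ≤ lam) {A : Set Plane} (hA : MeasurableSet A) (hA' : Bornology.IsBounded A)
    (c : ℝ≥0∞) :
    ∫⁻ ω, expNeg (pointCount x A ω * c) ∂P
      = expNeg (ENNReal.ofReal lam * ((1 - expNeg c) * volume A)) := by
  have hm : Measurable fun n : ℕ∞ => expNeg ((n : ℝ≥0∞) * c) := measurable_from_top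
  have h1 := (h.hasLaw A hA hA').lintegral_comp hm.aemeasurable
  have hv : (((lam * volume.real A).toNNReal : NNReal) : ℝ≥0∞)
      = ENNReal.ofReal lam * volume A := by
    rw [← ENNReal.ofReal, ENNReal.ofReal_mul hlam, ofReal_measureReal hA'.measure_lt_top.ne]
  refine h1.trans ?_
  rw [lintegral_map hm measurable_from_top]
  refine (lintegral_expNeg_poissonMeasure _ c).trans ?_
  rw [hv, mul_assoc, mul_comm (volume A)]

theorem IsHomogeneousPPP.lintegral_expNeg_sum_pointCount (h : IsHomogeneousPPP P lam x)
    (hlam : 0 ≤ lam) {ι : Type*} [Fintype ι] {A : ι → Set Plane} (hA : ∀ i, MeasurableSet (A i))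
    (hA' : ∀ i, Bornology.IsBounded (A i)) (hd : Pairwise fun i j => Disjoint (A i) (A j))
    (c : ι → ℝ≥0∞) :
    ∫⁻ ω, expNeg (∑ i, pointCount x (A i) ω * c i) ∂P
      = expNeg (ENNReal.ofReal lam * ∑ i, (1 - expNeg (c i)) * volume (A i)) := by
  -- Independence in the model is stated for families over `Fin r`; the index type is transported
  -- there.
  let e := Fintype.equivFin ι
  have hind := h.indep _ (fun i => A (e.symm i)) (fun i => hA _) (fun i => hA' _)
    (fun i j hij => hd (e.symm.injective.ne hij))
  have hind' := hind.comp (fun i (n : ℕ∞) => expNeg ((n : ℝ≥0∞) * c (e.symm i)))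
    (fun i => measurable_from_top)
  have key := lintegral_prod_eq_prod_lintegral_of_indepFun Finset.univ _ hind'
    (fun i => measurable_expNeg.comp ((h.measurable_pointCount (hA _)).mul_const _))
  simp only [Function.comp_apply] at key
  rw [e.symm.prod_comp fun i => ∫⁻ ω, expNeg (pointCount x (A i) ω * c i) ∂P] at key
  rw [Finset.mul_sum, expNeg_sum]
  simp_rw [← h.lintegral_expNeg_pointCount hlam (hA _) (hA' _), ← key]
  refine lintegral_congr fun ω => ?_
  rw [expNeg_sum, e.symm.prod_comp fun i => expNeg (pointCount x (A i) ω * c i)]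

/-- The sum over points is a combination of counts in the disjoint level sets of `f`. Cutting off to
`B` keeps these sets bounded, as the model only prescribes counts there. -/
theorem IsHomogeneousPPP.lintegral_expNeg_tsum_simpleFunc (h : IsHomogeneousPPP P lam x)
    (hlam : 0 ≤ lam) (f : SimpleFunc Plane ℝ≥0∞) {B : Set Plane} (hB : MeasurableSet B)
    (hB' : Bornology.IsBounded B) :
    ∫⁻ ω, expNeg (∑' k, B.indicator f (x k ω)) ∂P
      = expNeg (ENNReal.ofReal lam * ∫⁻ y in B, (1 - expNeg (f y))) := by
  have key := h.lintegral_expNeg_sum_pointCount hlam (ι := f.range)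
    (A := fun i => f ⁻¹' {(i : ℝ≥0∞)} ∩ B)
    (fun i => (f.measurableSet_fiber _).inter hB) (fun i => hB'.subset Set.inter_subset_right)
    (fun i j hij => by
      refine Set.disjoint_left.2 fun y hy hy' => hij (Subtype.ext ?_)
      exact hy.1.symm.trans hy'.1) (fun i => i)
  have hsum : ∀ ω, ∑' k, B.indicator f (x k ω)
      = ∑ i : f.range, (pointCount x (f ⁻¹' {(i : ℝ≥0∞)} ∩ B) ω : ℝ≥0∞) * i := by
    intro ω
    simp_rw [← tsum_indicator_const_eq]
    rw [← Summable.tsum_finsetSum fun _ _ => ENNReal.summable]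
    refine tsum_congr fun k => ?_
    by_cases hk : x k ω ∈ B
    · rw [Set.indicator_of_mem hk, Finset.sum_eq_single (⟨f (x k ω), f.mem_range_self _⟩ : f.range)]
      · exact (Set.indicator_of_mem
          (show x k ω ∈ f ⁻¹' {f (x k ω)} ∩ B from ⟨rfl, hk⟩) _).symm
      · intro i _ hi
        refine Set.indicator_of_notMem (fun hmem => hi (Subtype.ext ?_)) _
        exact hmem.1.symm
      · simp
    · rw [Set.indicator_of_notMem hk]
      exact (Finset.sum_eq_zero fun i _ =>
        Set.indicator_of_notMem (fun hmem => hk hmem.2) _).symm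
  have hint : ∫⁻ y in B, (1 - expNeg (f y))
      = ∑ i : f.range, (1 - expNeg i) * volume (f ⁻¹' {(i : ℝ≥0∞)} ∩ B) := by
    have := (f.map fun t => 1 - expNeg t).lintegral_eq_lintegral (volume.restrict B)
    rw [SimpleFunc.map_lintegral] at this
    refine this.trans ?_
    rw [← Finset.sum_coe_sort]
    exact Finset.sum_congr rfl fun i _ => by
      rw [Measure.restrict_apply (f.measurableSet_fiber _)]
  simp_rw [hsum, key, hint]

/-- Monotone convergence for the counting measure. -/
theorem tsum_tendsto_of_monotone {F : ℕ → ℕ → ℝ≥0∞} {f : ℕ → ℝ≥0∞}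
    (hmono : ∀ k, Monotone fun n => F n k)
    (h : ∀ k, Filter.Tendsto (fun n => F n k) Filter.atTop (nhds (f k))) :
    Filter.Tendsto (fun n => ∑' k, F n k) Filter.atTop (nhds (∑' k, f k)) := by
  simp_rw [← lintegral_count]
  exact lintegral_tendsto_of_tendsto_of_monotone (fun n => measurable_from_top.aemeasurable)
    (ae_of_all _ hmono) (ae_of_all _ h)

/-- The Laplace functional of a homogeneous Poisson point process. -/
theorem IsHomogeneousPPP.lintegral_expNeg_tsum [IsFiniteMeasure P]
    (h : IsHomogeneousPPP P lam x) (hlam : 0 ≤ lam) {φ : Plane → ℝ≥0∞} (hφ : Measurable φ) :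
    ∫⁻ ω, expNeg (∑' k, φ (x k ω)) ∂P
      = expNeg (ENNReal.ofReal lam * ∫⁻ y, (1 - expNeg (φ y))) := by
  let B : ℕ → Set Plane := fun n => Metric.ball 0 n
  let F : ℕ → Plane → ℝ≥0∞ := fun n => (B n).indicator (SimpleFunc.eapprox φ n)
  have hBm : ∀ n, MeasurableSet (B n) := fun n => measurableSet_ball
  have hFm : ∀ n, Measurable (F n) := fun n => (SimpleFunc.measurable _).indicator (hBm n)
  have hmono : ∀ y, Monotone fun n => F n y := by
    intro y m n hmn
    refine (Set.indicator_le_indicator (SimpleFunc.monotone_eapprox φ hmn y)).trans ?_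
    exact Set.indicator_le_indicator_of_subset
      (Metric.ball_subset_ball (by exact_mod_cast hmn)) (fun _ => zero_le) y
  have hlim : ∀ y, Filter.Tendsto (fun n => F n y) Filter.atTop (nhds (φ y)) := by
    intro y
    refine (SimpleFunc.tendsto_eapprox hφ y).congr' ?_
    obtain ⟨N, hN⟩ := exists_nat_gt ‖y‖
    filter_upwards [Filter.eventually_ge_atTop N] with n hn
    refine (Set.indicator_of_mem ?_ _).symm
    exact mem_ball_zero_iff.2 (hN.trans_le (by exact_mod_cast hn))
  have hleft := tendsto_lintegral_expNeg (μ := P) (F := fun n ω => ∑' k, F n (x k ω))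
    (fun n => Measurable.tsum fun k => (hFm n).comp (h.measurable k))
    (fun ω => tsum_tendsto_of_monotone (fun k => hmono (x k ω)) fun k => hlim (x k ω))
  -- The plane has infinite area, so bounded domination is unavailable; `1 - e^(-F_n)` increases
  -- with `n`, and monotone convergence applies.
  have hright : Filter.Tendsto (fun n => ∫⁻ y, (1 - expNeg (F n y))) Filter.atTop
      (nhds (∫⁻ y, (1 - expNeg (φ y)))) := by
    refine lintegral_tendsto_of_tendsto_of_monotone
      (fun n => (measurable_const.sub (measurable_expNeg.comp (hFm n))).aemeasurable)
      (ae_of_all _ fun y m n hmn => tsub_le_tsub_left (antitone_expNeg (hmono y hmn)) _)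
      (ae_of_all _ fun y => ?_)
    exact ENNReal.Tendsto.sub tendsto_const_nhds
      ((continuous_expNeg.tendsto _).comp (hlim y)) (Or.inl ENNReal.one_ne_top)
  refine tendsto_nhds_unique hleft ?_
  have heq : ∀ n, ∫⁻ ω, expNeg (∑' k, F n (x k ω)) ∂P
      = expNeg (ENNReal.ofReal lam * ∫⁻ y, (1 - expNeg (F n y))) := by
    intro n
    refine (h.lintegral_expNeg_tsum_simpleFunc hlam (SimpleFunc.eapprox φ n) (hBm n)
      Metric.isBounded_ball).trans ?_
    rw [← lintegral_indicator (hBm n)]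
    congr 2
    refine lintegral_congr fun y => ?_
    by_cases hy : y ∈ B n <;> simp [F, hy]
  simp_rw [heq]
  exact (continuous_expNeg.tendsto _).comp
    (ENNReal.Tendsto.const_mul hright (Or.inr ENNReal.ofReal_ne_top))

end PoissonPointProcess

/-! ### The Laplace transform of the harvested energy -/

/-- The value is `1 / (1 + d)`; writing it as `e^(-log(1+d))` lets the averaged fading serve as a
new test function in the Laplace functional. -/
theorem lintegral_expNeg_expMeasure {d : ℝ} (hd : 0 ≤ d) :
    ∫⁻ h, expNeg (ENNReal.ofReal (h * d)) ∂(expMeasure 1)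
      = expNeg (ENNReal.ofReal (Real.log (1 + d))) := by
  have hd1 : 0 < 1 + d := by linarith
  have hm : Measurable fun h : ℝ => expNeg (ENNReal.ofReal (h * d)) :=
    measurable_expNeg.comp (by fun_prop)
  have hpdf : Measurable (exponentialPDF 1) :=
    (measurable_exponentialPDFReal 1).ennreal_ofReal
  have hpdf' : Measurable (exponentialPDF (1 + d)) :=
    (measurable_exponentialPDFReal (1 + d)).ennreal_ofReal
  -- Exponential tilting turns the rate `1` density into a multiple of the rate `1 + d` density.
  have hprod : ∀ h : ℝ, exponentialPDF 1 h * expNeg (ENNReal.ofReal (h * d))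
      = ENNReal.ofReal ((1 + d)⁻¹) * exponentialPDF (1 + d) h := by
    intro h
    rcases lt_or_ge h 0 with hh | hh
    · rw [exponentialPDF_of_neg hh, exponentialPDF_of_neg hh, zero_mul, mul_zero]
    · rw [exponentialPDF_of_nonneg hh, exponentialPDF_of_nonneg hh,
        expNeg_ofReal (mul_nonneg hh hd), ← ENNReal.ofReal_mul (by positivity),
        ← ENNReal.ofReal_mul (by positivity), inv_mul_cancel_left₀ hd1.ne', one_mul, one_mul,
        ← Real.exp_add]
      congr 2
      ring
  have hexp : expMeasure 1 = volume.withDensity (exponentialPDF 1) := rfl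
  rw [hexp, lintegral_withDensity_eq_lintegral_mul _ hpdf hm]
  simp only [Pi.mul_apply]
  simp_rw [hprod]
  rw [lintegral_const_mul _ hpdf',
    lintegral_exponentialPDF_eq_one hd1, mul_one,
    expNeg_ofReal (Real.log_nonneg (by linarith)), Real.exp_neg, Real.exp_log hd1]

/-! ### Averaging over the fading -/

section Fading

variable {Ω : Type*} [MeasurableSpace Ω] {P : Measure Ω} {H : ℕ → Ω → ℝ}

theorem lintegral_expNeg_tsum_exp_mul [IsFiniteMeasure P] (hHm : ∀ k, Measurable (H k))
    (hH : ∀ k, HasLaw (H k) (expMeasure 1) P) (hind : iIndepFun H P) {d : ℕ → ℝ}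
    (hd : ∀ k, 0 ≤ d k) :
    ∫⁻ ω, expNeg (∑' k, ENNReal.ofReal (H k ω * d k)) ∂P
      = expNeg (∑' k, ENNReal.ofReal (Real.log (1 + d k))) := by
  have hm : ∀ k, Measurable fun h : ℝ => expNeg (ENNReal.ofReal (h * d k)) :=
    fun k => measurable_expNeg.comp (by fun_prop)
  have hleft := tendsto_lintegral_expNeg (μ := P)
    (F := fun n ω => ∑ k ∈ Finset.range n, ENNReal.ofReal (H k ω * d k))
    (fun n => Finset.measurable_sum _ fun k _ => ((hHm k).mul_const _).ennreal_ofReal)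
    (fun ω => ENNReal.tendsto_nat_tsum _)
  refine tendsto_nhds_unique hleft ?_
  have heq : ∀ n, ∫⁻ ω, expNeg (∑ k ∈ Finset.range n, ENNReal.ofReal (H k ω * d k)) ∂P
      = ∏ k ∈ Finset.range n, expNeg (ENNReal.ofReal (Real.log (1 + d k))) := by
    intro n
    simp_rw [expNeg_sum]
    refine (lintegral_prod_eq_prod_lintegral_of_indepFun (Finset.range n) _
      (hind.comp _ hm) fun k => (hm k).comp (hHm k)).trans ?_
    refine Finset.prod_congr rfl fun k _ => ?_
    exact ((hH k).lintegral_comp (hm k).aemeasurable).trans (lintegral_expNeg_expMeasure (hd k))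
  simp_rw [heq]
  exact tendsto_expNeg_sum_range _

/-- By independence and Fubini the fading is integrated with the beacons frozen, which reduces the
marked process to the unmarked one. -/
theorem lintegral_expNeg_tsum_marked [IsProbabilityMeasure P] {lam : ℝ} {x : ℕ → Ω → Plane}
    (hx : IsHomogeneousPPP P lam x) (hlam : 0 ≤ lam) (hHm : ∀ k, Measurable (H k))
    (hH : ∀ k, HasLaw (H k) (expMeasure 1) P) (hind : iIndepFun H P)
    (hxH : IndepFun (fun ω k => x k ω) (fun ω k => H k ω) P) {d : Plane → ℝ}
    (hdm : Measurable d) (hd : ∀ y, 0 ≤ d y) :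
    ∫⁻ ω, expNeg (∑' k, ENNReal.ofReal (H k ω * d (x k ω))) ∂P
      = expNeg (ENNReal.ofReal lam *
          ∫⁻ y, (1 - expNeg (ENNReal.ofReal (Real.log (1 + d y))))) := by
  have hxm : Measurable fun ω k => x k ω := measurable_pi_lambda _ hx.measurable
  have hHm' : Measurable fun ω k => H k ω := measurable_pi_lambda _ hHm
  have hprod := (indepFun_iff_map_prod_eq_prod_map_map hxm.aemeasurable hHm'.aemeasurable).1 hxH
  have hm : Measurable fun p : (ℕ → Plane) × (ℕ → ℝ) =>
      expNeg (∑' k, ENNReal.ofReal (p.2 k * d (p.1 k))) := by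
    refine measurable_expNeg.comp (Measurable.tsum fun k => Measurable.ennreal_ofReal ?_)
    exact ((measurable_pi_apply k).comp measurable_snd).mul
      (hdm.comp ((measurable_pi_apply k).comp measurable_fst))
  have : IsProbabilityMeasure (P.map fun ω k => H k ω) :=
    Measure.isProbabilityMeasure_map hHm'.aemeasurable
  rw [← hx.lintegral_expNeg_tsum hlam (φ := fun y => ENNReal.ofReal (Real.log (1 + d y)))
    (by fun_prop)]
  calc ∫⁻ ω, expNeg (∑' k, ENNReal.ofReal (H k ω * d (x k ω))) ∂P
      = ∫⁻ p, expNeg (∑' k, ENNReal.ofReal (p.2 k * d (p.1 k)))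
          ∂(P.map fun ω => ((fun k => x k ω), fun k => H k ω)) :=
        (lintegral_map hm (hxm.prodMk hHm')).symm
    _ = ∫⁻ u, ∫⁻ h, expNeg (∑' k, ENNReal.ofReal (h k * d (u k)))
          ∂(P.map fun ω k => H k ω) ∂(P.map fun ω k => x k ω) := by
        rw [hprod, lintegral_prod _ hm.aemeasurable]
    _ = ∫⁻ ω, ∫⁻ h, expNeg (∑' k, ENNReal.ofReal (h k * d (x k ω)))
          ∂(P.map fun ω k => H k ω) ∂P :=
        lintegral_map hm.lintegral_prod_right' hxm
    _ = _ := by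
        refine lintegral_congr fun ω => ?_
        rw [← lintegral_expNeg_tsum_exp_mul hHm hH hind fun k => hd (x k ω)]
        exact lintegral_map (hm.comp measurable_prodMk_left) hHm'

end Fading

/-! ### Integrating the path loss over the plane -/

section PathLoss

variable {η t : ℝ}

theorem pathLoss_pos (r η : ℝ) : 0 < pathLoss r η := one_pos.trans_le (le_max_left _ _)

theorem measurable_pathLoss (η : ℝ) : Measurable fun r => pathLoss r η :=
  measurable_const.max (by fun_prop)

theorem pathLoss_of_le_one (hη : 2 < η) {r : ℝ} (h0 : 0 < r) (h1 : r ≤ 1) :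
    pathLoss r η = 1 :=
  max_eq_left (Real.rpow_le_one h0.le h1 (by linarith))

theorem pathLoss_of_one_lt (hη : 2 < η) {r : ℝ} (h1 : 1 < r) : pathLoss r η = r ^ η :=
  max_eq_right (Real.one_lt_rpow h1 (by linarith)).le

/-- The weight `r ^ (2 - 1)` is the polar Jacobian in dimension two, kept in the form given by
integration of radial functions. -/
theorem radial_eqOn_Ioc (hη : 2 < η) :
    Set.EqOn (fun r => r ^ (2 - 1) • (t / (t + pathLoss r η))) (fun r => r * (t / (t + 1)))
      (Set.Ioc 0 1) := fun r hr => by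
  simp [pathLoss_of_le_one hη hr.1 hr.2]

theorem radial_eqOn_Ioi (hη : 2 < η) :
    Set.EqOn (fun r => r ^ (2 - 1) • (t / (t + pathLoss r η)))
      (fun r => t * (r / (r ^ η - -t) ^ (0 + 1))) (Set.Ioi 1) := fun r hr => by
  simp only [pathLoss_of_one_lt hη hr, smul_eq_mul]
  ring

theorem integrableOn_radial_Ioc (hη : 2 < η) :
    IntegrableOn (fun r => r ^ (2 - 1) • (t / (t + pathLoss r η))) (Set.Ioc 0 1) := by
  refine IntegrableOn.congr_fun ?_ (radial_eqOn_Ioc hη).symm measurableSet_Ioc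
  have : Continuous fun r : ℝ => r * (t / (t + 1)) := by fun_prop
  exact this.integrableOn_Ioc

theorem integrableOn_radial_Ioi (hη : 2 < η) (ht : 0 < t) :
    IntegrableOn (fun r => r ^ (2 - 1) • (t / (t + pathLoss r η))) (Set.Ioi 1) :=
  IntegrableOn.congr_fun ((integrableOn_resolvent hη (by linarith) 0).const_mul t)
    (radial_eqOn_Ioi hη).symm measurableSet_Ioi

theorem integral_radial (hη : 2 < η) (ht : 0 < t) :
    ∫ r in Set.Ioi (0 : ℝ), r ^ (2 - 1) • (t / (t + pathLoss r η))
      = (t / (1 + t) + hypF 0 t η) / 2 := by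
  rw [← Set.Ioc_union_Ioi_eq_Ioi (zero_le_one' ℝ), setIntegral_union (Set.Ioc_disjoint_Ioi le_rfl)
    measurableSet_Ioi (integrableOn_radial_Ioc hη) (integrableOn_radial_Ioi hη ht),
    setIntegral_congr_fun measurableSet_Ioc (radial_eqOn_Ioc hη),
    setIntegral_congr_fun measurableSet_Ioi (radial_eqOn_Ioi hη),
    ← intervalIntegral.integral_of_le zero_le_one, intervalIntegral.integral_mul_const,
    integral_id, integral_const_mul, hypF_zero_eq hη ht, resolventIntegral, add_comm 1 t]
  ring

theorem integrable_plane (hη : 2 < η) (ht : 0 < t) :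
    Integrable fun y : Plane => t / (t + pathLoss ‖y‖ η) := by
  rw [integrable_fun_norm_addHaar volume (f := fun r => t / (t + pathLoss r η)),
    finrank_euclideanSpace_fin, ← Set.Ioc_union_Ioi_eq_Ioi (zero_le_one' ℝ)]
  exact (integrableOn_radial_Ioc hη).union (integrableOn_radial_Ioi hη ht)

theorem integral_plane (hη : 2 < η) (ht : 0 < t) :
    ∫ y : Plane, t / (t + pathLoss ‖y‖ η) = Real.pi * (t / (1 + t) + hypF 0 t η) := by
  rw [integral_fun_norm_addHaar volume fun r => t / (t + pathLoss r η),
    finrank_euclideanSpace_fin, integral_radial hη ht, measureReal_def,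
    EuclideanSpace.volume_ball_fin_two]
  simp [ENNReal.toReal_ofReal Real.pi_nonneg]
  ring

/-- The integrand is `1 - 1/(1 + t/ℓ) = t/(t + ℓ)`. -/
theorem lintegral_plane (hη : 2 < η) (ht : 0 < t) :
    ∫⁻ y : Plane, (1 - expNeg (ENNReal.ofReal (Real.log (1 + t / pathLoss ‖y‖ η))))
      = ENNReal.ofReal (Real.pi * (t / (1 + t) + hypF 0 t η)) := by
  rw [← integral_plane hη ht, ofReal_integral_eq_lintegral_ofReal (integrable_plane hη ht)
    (ae_of_all _ fun y => div_nonneg ht.le (add_pos ht (pathLoss_pos _ _)).le)]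
  refine lintegral_congr fun y => ?_
  have hl := pathLoss_pos ‖y‖ η
  have h1 : 0 < 1 + t / pathLoss ‖y‖ η := by positivity
  rw [expNeg_ofReal (Real.log_nonneg (by simp; positivity)), Real.exp_neg, Real.exp_log h1,
    ← ENNReal.ofReal_one, ← ENNReal.ofReal_sub _ (by positivity)]
  congr 1
  field_simp
  ring

end PathLoss

/-! ### Laplace transform of the shot noise -/

section Energy

variable {Ω : Type*} [MeasurableSpace Ω] {P : Measure Ω} {x : ℕ → Ω → Plane} {H : ℕ → Ω → ℝ}

/-- The normalised energy `∑ₖ H_k / ℓ(‖x_k‖, η)`. -/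
noncomputable def shotNoise (η : ℝ) (x : ℕ → Plane) (H : ℕ → ℝ) : ℝ≥0∞ :=
  ∑' k, ENNReal.ofReal (H k / pathLoss ‖x k‖ η)

theorem measurable_shotNoise (η : ℝ) :
    Measurable fun p : (ℕ → Plane) × (ℕ → ℝ) => shotNoise η p.1 p.2 := by
  refine Measurable.tsum fun k => Measurable.ennreal_ofReal ?_
  exact ((measurable_pi_apply k).comp measurable_snd).div
    ((measurable_pathLoss η).comp ((measurable_pi_apply k).comp measurable_fst).norm)

/-- The Laplace transform of the shot noise with Rayleigh fading. -/
theorem lintegral_expNeg_shotNoise [IsProbabilityMeasure P] {lam η : ℝ}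
    (hx : IsHomogeneousPPP P lam x) (hlam : 0 ≤ lam) (hη : 2 < η) (hHm : ∀ k, Measurable (H k))
    (hH : ∀ k, HasLaw (H k) (expMeasure 1) P) (hind : iIndepFun H P)
    (hxH : IndepFun (fun ω k => x k ω) (fun ω k => H k ω) P) {t : ℝ} (ht : 0 < t) :
    ∫⁻ ω, expNeg (ENNReal.ofReal t * shotNoise η (fun k => x k ω) fun k => H k ω) ∂P
      = ENNReal.ofReal (Real.exp (logLaplace lam η t)) := by
  have hdm : Measurable fun y : Plane => t / pathLoss ‖y‖ η :=
    measurable_const.div ((measurable_pathLoss η).comp measurable_norm)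
  have key := lintegral_expNeg_tsum_marked hx hlam hHm hH hind hxH hdm
    fun y => div_nonneg ht.le (pathLoss_pos _ _).le
  have hnonneg : 0 ≤ Real.pi * (t / (1 + t) + hypF 0 t η) := by
    rw [← integral_plane hη ht]
    exact integral_nonneg fun y => div_nonneg ht.le (add_pos ht (pathLoss_pos _ _)).le
  rw [lintegral_plane hη ht, ← ENNReal.ofReal_mul hlam,
    expNeg_ofReal (mul_nonneg hlam hnonneg)] at key
  convert! key using 1
  · refine lintegral_congr fun ω => ?_
    rw [shotNoise, ← ENNReal.tsum_mul_left]
    congr 1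
    refine tsum_congr fun k => ?_
    rw [← ENNReal.ofReal_mul ht.le]
    congr 1
    ring
  · rw [logLaplace]
    congr 2
    ring

end Energy

/-! ### The sum of the squares of an even number of Gaussian variables -/

theorem integrableOn_pow_mul_cexp_neg {c : ℂ} (hc : 0 < c.re) (k : ℕ) :
    IntegrableOn (fun x : ℝ => (x : ℂ) ^ k * Complex.exp (-(c * x))) (Set.Ioi 0) := by
  have h := integrableOn_rpow_mul_exp_neg_mul_rpow (p := 1) (s := k) (b := c.re)
    (by linarith [k.cast_nonneg (α := ℝ)]) one_pos hc
  refine h.mono' (Continuous.aestronglyMeasurable (by fun_prop)) ?_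
  filter_upwards [ae_restrict_mem measurableSet_Ioi] with x hx
  have hx0 : 0 < x := hx
  rw [norm_mul, norm_pow, Complex.norm_real, Real.norm_of_nonneg hx0.le, Complex.norm_exp,
    Real.rpow_natCast, Real.rpow_one]
  simp

theorem tendsto_pow_mul_cexp_neg {c : ℂ} (hc : 0 < c.re) (k : ℕ) :
    Filter.Tendsto (fun x : ℝ => (x : ℂ) ^ k * Complex.exp (-(c * x))) Filter.atTop (nhds 0) := by
  rw [tendsto_zero_iff_norm_tendsto_zero]
  have h := (Real.tendsto_pow_mul_exp_neg_atTop_nhds_zero k).comp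
    (Filter.tendsto_id.const_mul_atTop hc)
  have h' := h.const_mul ((c.re ^ k)⁻¹)
  rw [mul_zero] at h'
  refine h'.congr' ?_
  filter_upwards [Filter.eventually_gt_atTop 0] with x hx
  rw [norm_mul, norm_pow, Complex.norm_real, Real.norm_of_nonneg hx.le, Complex.norm_exp]
  simp only [Function.comp_apply, id, mul_pow]
  rw [mul_assoc, inv_mul_cancel_left₀ (pow_ne_zero _ hc.ne')]
  simp

/-- Integration by parts in `k`. Complex `c` is needed because characteristic functions of Gamma
laws use `c = r - it`. -/
theorem integral_pow_mul_cexp_neg {c : ℂ} (hc : 0 < c.re) (k : ℕ) :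
    ∫ x in Set.Ioi (0 : ℝ), (x : ℂ) ^ k * Complex.exp (-(c * x))
      = (k.factorial : ℂ) / c ^ (k + 1) := by
  have hc0 : c ≠ 0 := fun h => by simp [h] at hc
  have hexp : ∀ x : ℝ, HasDerivAt (fun x : ℝ => Complex.exp (-(c * x)))
      (Complex.exp (-(c * x)) * -c) x := fun x => by
    have := ((Complex.ofRealCLM.hasDerivAt (x := x)).const_mul c).neg.cexp
    simpa using this
  induction k with
  | zero =>
    have h := integral_Ioi_of_hasDerivAt_of_tendsto (a := 0) (m := 0)
      (f := fun x : ℝ => Complex.exp (-(c * x))) (f' := fun x : ℝ => Complex.exp (-(c * x)) * -c)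
      (by fun_prop) (fun x _ => hexp x)
      (by simpa [IntegrableOn] using (integrableOn_pow_mul_cexp_neg hc 0).mul_const (-c))
      (by simpa using tendsto_pow_mul_cexp_neg hc 0)
    rw [integral_mul_const] at h
    simp only [pow_zero, one_mul, Nat.factorial_zero, Nat.cast_one, zero_add, pow_one]
    rw [eq_div_iff hc0]
    simp at h
    linear_combination h
  | succ k ih =>
    have hi := (integrableOn_pow_mul_cexp_neg hc k).const_mul ((k : ℂ) + 1)
    have hi' := (integrableOn_pow_mul_cexp_neg hc (k + 1)).const_mul c
    have h := integral_Ioi_of_hasDerivAt_of_tendsto (a := 0) (m := 0)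
      (f := fun x : ℝ => (x : ℂ) ^ (k + 1) * Complex.exp (-(c * x)))
      (f' := fun x : ℝ => ((k : ℂ) + 1) * ((x : ℂ) ^ k * Complex.exp (-(c * x)))
        - c * ((x : ℂ) ^ (k + 1) * Complex.exp (-(c * x))))
      (by fun_prop)
      (fun x _ => by
        have h1 := (Complex.ofRealCLM.hasDerivAt (x := x)).pow (k + 1)
        refine (h1.mul (hexp x)).congr_deriv ?_
        simp
        ring)
      (hi.sub hi') (tendsto_pow_mul_cexp_neg hc (k + 1))
    rw [integral_sub hi hi', integral_const_mul, integral_const_mul, ih] at h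
    rw [Nat.factorial_succ, eq_div_iff (pow_ne_zero _ hc0)]
    simp at h
    field_simp at h
    push_cast
    rw [pow_succ c (k + 1)]
    linear_combination -h

theorem charFun_gammaMeasure_natCast_succ {r : ℝ} (hr : 0 < r) (k : ℕ) (t : ℝ) :
    charFun (gammaMeasure (k + 1 : ℕ) r) t = ((r : ℂ) / (r - t * Complex.I)) ^ (k + 1) := by
  have hm : Measurable (gammaPDF (k + 1 : ℕ) r) := (measurable_gammaPDFReal _ _).ennreal_ofReal
  rw [charFun_apply_real, gammaMeasure, integral_withDensity_eq_integral_toReal_smul hm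
    (ae_of_all _ fun _ => ENNReal.ofReal_lt_top)]
  have hk : (0 : ℝ) < (k + 1 : ℕ) := by positivity
  have hc : 0 < ((r : ℂ) - t * Complex.I).re := by simpa using hr
  have key : ∀ x : ℝ, (gammaPDF (k + 1 : ℕ) r x).toReal • Complex.exp (t * x * Complex.I)
      = (Set.Ici (0 : ℝ)).indicator (fun x : ℝ => ((r : ℂ) ^ (k + 1) / (k.factorial : ℂ)) *
        ((x : ℂ) ^ k * Complex.exp (-((r - t * Complex.I) * x)))) x := by
    intro x
    rw [gammaPDF, ENNReal.toReal_ofReal (gammaPDFReal_nonneg hk hr x), gammaPDFReal]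
    by_cases hx : 0 ≤ x
    · rw [if_pos hx, Set.indicator_of_mem (Set.mem_Ici.2 hx), Nat.cast_succ, add_sub_cancel_right,
        Real.rpow_natCast, Real.Gamma_nat_eq_factorial, ← Nat.cast_succ, Real.rpow_natCast,
        Complex.real_smul, Nat.succ_eq_add_one]
      push_cast
      have : Complex.exp (-((r - t * Complex.I) * x))
          = Complex.exp (-(r * x)) * Complex.exp (t * x * Complex.I) := by
        rw [← Complex.exp_add]; ring_nf
      rw [this]
      ring
    · rw [if_neg hx, Set.indicator_of_notMem (by simpa using hx), zero_smul]
  simp_rw [key]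
  rw [integral_indicator measurableSet_Ici, integral_Ici_eq_integral_Ioi, integral_const_mul,
    integral_pow_mul_cexp_neg hc, div_pow]
  have : (k.factorial : ℂ) ≠ 0 := by exact_mod_cast k.factorial_ne_zero
  field_simp

/-- The Gaussian integral with complex `b` gives a complex square root; squaring removes the branch.
Hence the Gaussians are taken in pairs, each pair being exponential of rate `1/(2v)`. -/
theorem sq_charFun_gaussianReal_sq {v : NNReal} (hv : v ≠ 0) (t : ℝ) :
    (∫ x, Complex.exp (t * (x ^ 2 : ℝ) * Complex.I) ∂(gaussianReal 0 v)) ^ 2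
      = ((1 / (2 * v) : ℝ) : ℂ) / ((1 / (2 * v) : ℝ) - t * Complex.I) := by
  have hv0 : (0 : ℝ) < v := by positivity
  have hb : 0 < (((1 / (2 * v) : ℝ) : ℂ) - t * Complex.I).re := by simpa using hv0
  set b : ℂ := ((1 / (2 * v) : ℝ) : ℂ) - t * Complex.I with hbdef
  have hb0 : b ≠ 0 := fun h => by simp [h] at hb
  rw [integral_gaussianReal_eq_integral_smul hv]
  have key : ∀ x : ℝ, gaussianPDFReal 0 v x • Complex.exp (t * (x ^ 2 : ℝ) * Complex.I)
      = (((√(2 * Real.pi * v))⁻¹ : ℝ) : ℂ) * Complex.exp (-b * x ^ 2) := by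
    intro x
    rw [gaussianPDFReal, Complex.real_smul]
    push_cast
    rw [mul_assoc, ← Complex.exp_add]
    congr 2
    rw [hbdef]
    push_cast
    ring
  simp_rw [key]
  rw [integral_const_mul, integral_gaussian_complex hb, mul_pow, one_div (2 : ℂ),
    show (2 : ℂ)⁻¹ = ((2 : ℕ) : ℂ)⁻¹ by norm_num, Complex.cpow_nat_inv_pow _ two_ne_zero,
    ← Complex.ofReal_pow, inv_pow, Real.sq_sqrt (by positivity)]
  have hpi : (Real.pi : ℂ) ≠ 0 := by exact_mod_cast Real.pi_ne_zero
  have hvc : (v : ℂ) ≠ 0 := by exact_mod_cast hv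
  push_cast
  field_simp

theorem map_sum_sq_gaussian {Ω : Type*} [MeasurableSpace Ω] {P : Measure Ω} {v : NNReal}
    (hv : v ≠ 0) (k : ℕ) {ι : Type*} [Fintype ι] (hι : Fintype.card ι = 2 * (k + 1))
    {X : ι → Ω → ℝ} (hm : ∀ i, Measurable (X i)) (hX : ∀ i, HasLaw (X i) (gaussianReal 0 v) P)
    (hind : iIndepFun X P) :
    P.map (fun ω => ∑ i, X i ω ^ 2) = gammaMeasure (k + 1 : ℕ) (1 / (2 * v)) := by
  have : IsProbabilityMeasure P := hind.isProbabilityMeasure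
  have hv0 : (0 : ℝ) < v := by positivity
  have hr : (0 : ℝ) < 1 / (2 * v) := by positivity
  have : IsProbabilityMeasure (gammaMeasure (k + 1 : ℕ) (1 / (2 * (v : ℝ)))) :=
    isProbabilityMeasure_gammaMeasure (by positivity) hr
  have hsq : Measurable fun x : ℝ => x ^ 2 := by fun_prop
  have hind' := hind.comp (fun _ x => x ^ 2) fun _ => hsq
  have hm' : ∀ i, Measurable ((fun x : ℝ => x ^ 2) ∘ X i) := fun i => hsq.comp (hm i)
  refine Measure.ext_of_charFun (funext fun t => ?_)
  have h := congrFun (hind'.charFun_map_fun_sum_eq_prod fun i => (hm' i).aemeasurable) t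
  refine h.trans ?_
  have hone : ∀ i, charFun (P.map ((fun x : ℝ => x ^ 2) ∘ X i)) t
      = ∫ x, Complex.exp (t * (x ^ 2 : ℝ) * Complex.I) ∂(gaussianReal 0 v) := by
    intro i
    rw [charFun_apply_real, integral_map (hm' i).aemeasurable
      (Continuous.aestronglyMeasurable (by fun_prop))]
    exact (hX i).integral_comp (f := fun x : ℝ => Complex.exp (t * (x ^ 2 : ℝ) * Complex.I))
      (Continuous.aestronglyMeasurable (by fun_prop))
  rw [Finset.prod_apply, Finset.prod_congr rfl fun i _ => hone i, Finset.prod_const,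
    Finset.card_univ, hι, pow_mul, sq_charFun_gaussianReal_sq hv,
    charFun_gammaMeasure_natCast_succ hr]

/-- The distribution function of the Erlang distribution. -/
theorem gammaMeasure_natCast_succ_Ioi {r : ℝ} (hr : 0 < r) (k : ℕ) {q : ℝ} (hq : 0 ≤ q) :
    gammaMeasure (k + 1 : ℕ) r (Set.Ioi q) = ENNReal.ofReal
      (Real.exp (-(r * q)) * ∑ i ∈ Finset.range (k + 1), (r * q) ^ i / (i.factorial : ℝ)) := by
  -- Minus the claimed tail: an antiderivative of the density that vanishes at infinity. Raising `k`
  -- adds one term, whose derivative cancels the previous density.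
  let T : ℕ → ℝ → ℝ := fun k x =>
    -(Real.exp (-(r * x)) * ∑ i ∈ Finset.range (k + 1), (r * x) ^ i / (i.factorial : ℝ))
  have hlin : ∀ x : ℝ, HasDerivAt (fun x : ℝ => r * x) r x := fun x => by
    simpa using (hasDerivAt_id x).const_mul r
  have hT : ∀ k x, HasDerivAt (T k)
      (r * ((r * x) ^ k / (k.factorial : ℝ)) * Real.exp (-(r * x))) x := by
    intro k x
    induction k with
    | zero =>
      have h : T 0 = fun x => -Real.exp (-(r * x)) := by
        funext x
        simp [T]
      rw [h]
      refine (hlin x).neg.exp.neg.congr_deriv ?_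
      simp
      ring
    | succ k ih =>
      have h : T (k + 1) = fun x => T k x
          - Real.exp (-(r * x)) * ((r * x) ^ (k + 1) / ((k + 1).factorial : ℝ)) := by
        funext x
        simp only [T]
        rw [Finset.sum_range_succ]
        ring
      rw [h]
      refine (ih.sub ((hlin x).neg.exp.mul (((hlin x).pow (k + 1)).div_const _))).congr_deriv ?_
      simp only [Nat.factorial_succ, Nat.add_sub_cancel, Pi.neg_apply, Pi.pow_apply]
      push_cast
      field_simp
      ring
  have hpdf : ∀ x ∈ Set.Ioi q, gammaPDFReal (k + 1 : ℕ) r x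
      = r * ((r * x) ^ k / (k.factorial : ℝ)) * Real.exp (-(r * x)) := by
    intro x hx
    have hx0 : 0 ≤ x := hq.trans (le_of_lt hx)
    rw [gammaPDFReal, if_pos hx0, Nat.cast_succ, add_sub_cancel_right,
      Real.rpow_natCast, Real.Gamma_nat_eq_factorial, ← Nat.cast_succ, Real.rpow_natCast, mul_pow,
      pow_succ]
    ring
  have hnn : ∀ x ∈ Set.Ioi q,
      0 ≤ r * ((r * x) ^ k / (k.factorial : ℝ)) * Real.exp (-(r * x)) := by
    intro x hx
    have hx0 : 0 ≤ x := hq.trans (le_of_lt hx)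
    positivity
  have htend : Filter.Tendsto (T k) Filter.atTop (nhds 0) := by
    have hsum : Filter.Tendsto (fun y : ℝ => -∑ i ∈ Finset.range (k + 1),
        (y ^ i * Real.exp (-y)) / (i.factorial : ℝ)) Filter.atTop (nhds 0) := by
      have := (tendsto_finsetSum (Finset.range (k + 1)) fun i _ =>
        (Real.tendsto_pow_mul_exp_neg_atTop_nhds_zero i).div_const (i.factorial : ℝ)).neg
      simpa using this
    refine (hsum.comp (Filter.tendsto_id.const_mul_atTop hr)).congr fun x => ?_
    simp only [T, Function.comp_apply, id, Finset.mul_sum]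
    congr 1
    exact Finset.sum_congr rfl fun i _ => by ring
  have hcont : ContinuousWithinAt (T k) (Set.Ici q) q :=
    (hT k q).continuousAt.continuousWithinAt
  have hint := integrableOn_Ioi_deriv_of_nonneg hcont (fun x _ => hT k x) hnn htend
  have hval := integral_Ioi_of_hasDerivAt_of_nonneg hcont (fun x _ => hT k x) hnn htend
  rw [gammaMeasure, withDensity_apply _ measurableSet_Ioi]
  have hrw : ∫⁻ x in Set.Ioi q, gammaPDF (k + 1 : ℕ) r x = ∫⁻ x in Set.Ioi q,
      ENNReal.ofReal (r * ((r * x) ^ k / (k.factorial : ℝ)) * Real.exp (-(r * x))) :=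
    setLIntegral_congr_fun measurableSet_Ioi fun x hx => by
      rw [gammaPDF, hpdf x hx]
  rw [hrw, ← ofReal_integral_eq_lintegral_ofReal hint
    ((ae_restrict_iff' measurableSet_Ioi).2 (ae_of_all _ hnn)), hval]
  simp [T]

theorem measure_lt_sum_sq_gaussian {Ω : Type*} [MeasurableSpace Ω] {P : Measure Ω} {v : NNReal}
    (hv : v ≠ 0) (k : ℕ) {ι : Type*} [Fintype ι] (hι : Fintype.card ι = 2 * k)
    {X : ι → Ω → ℝ} (hm : ∀ i, Measurable (X i)) (hX : ∀ i, HasLaw (X i) (gaussianReal 0 v) P)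
    (hind : iIndepFun X P) {q : ℝ} (hq : 0 ≤ q) :
    P {ω | q < ∑ i, X i ω ^ 2} = ENNReal.ofReal (Real.exp (-(q / (2 * v))) *
      ∑ i ∈ Finset.range k, (q / (2 * v)) ^ i / (i.factorial : ℝ)) := by
  -- With no variables both sides vanish; the Gamma law is used only for positive shape.
  rcases k with _ | k
  · have : IsEmpty ι := Fintype.card_eq_zero_iff.1 (by simpa using hι)
    simp [hq.not_gt]
  · have hr : (0 : ℝ) < 1 / (2 * v) := by positivity
    have hmeas : Measurable fun ω => ∑ i, X i ω ^ 2 :=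
      Finset.measurable_sum _ fun i _ => (hm i).pow_const 2
    have h := gammaMeasure_natCast_succ_Ioi hr k hq
    rw [← map_sum_sq_gaussian hv k hι hm hX hind, Measure.map_apply hmeas measurableSet_Ioi,
      one_div_mul_eq_div] at h
    exact h

/-! ### From the Laplace transform to the energy supply probability -/

section Laplace

variable {Ω : Type*} [MeasurableSpace Ω] {P : Measure Ω} {S : Ω → ℝ≥0∞}

theorem measurableSet_ne_top (hS : Measurable S) : MeasurableSet {ω | S ω ≠ ∞} :=
  (hS (measurableSet_singleton ∞)).compl

theorem lintegral_expNeg_mul_eq_restrict (hS : Measurable S) {t : ℝ} (ht : 0 < t) :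
    ∫⁻ ω, expNeg (ENNReal.ofReal t * S ω) ∂P
      = ∫⁻ ω in {ω | S ω ≠ ∞}, ENNReal.ofReal (Real.exp (t * -(S ω).toReal)) ∂P := by
  rw [← lintegral_indicator (measurableSet_ne_top hS)]
  refine lintegral_congr fun ω => ?_
  by_cases hω : S ω = ∞
  · rw [Set.indicator_of_notMem (by simpa using hω), hω,
      ENNReal.mul_top (by simpa using ht), expNeg_top]
  · rw [Set.indicator_of_mem (by simpa using hω)]
    nth_rewrite 1 [← ENNReal.ofReal_toReal hω]
    rw [← ENNReal.ofReal_mul ht.le, expNeg_ofReal (by positivity), mul_neg]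

theorem Ioi_subset_integrableExpSet [IsFiniteMeasure P] (hS : Measurable S) :
    Set.Ioi 0 ⊆ integrableExpSet (fun ω => -(S ω).toReal) P := by
  intro t ht
  have ht0 : 0 < t := ht
  refine Integrable.of_bound (C := 1) (Measurable.aestronglyMeasurable
    (hS.ennreal_toReal.neg.const_mul t).exp) (ae_of_all _ fun ω => ?_)
  rw [Real.norm_of_nonneg (Real.exp_pos _).le, Real.exp_le_one_iff, mul_neg, neg_nonpos]
  positivity

/-- `toReal` sends `∞` to `0`, so without the restriction the event `S = ∞` would wrongly count with
weight `1`. As a moment generating function, `L` can be differentiated under the integral. -/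
theorem mgf_neg_toReal_restrict [IsFiniteMeasure P] (hS : Measurable S) {t : ℝ} (ht : 0 < t) :
    mgf (fun ω => -(S ω).toReal) (P.restrict {ω | S ω ≠ ∞}) t
      = (∫⁻ ω, expNeg (ENNReal.ofReal t * S ω) ∂P).toReal := by
  rw [lintegral_expNeg_mul_eq_restrict hS ht, mgf]
  exact integral_eq_lintegral_of_nonneg_ae (ae_of_all _ fun ω => (Real.exp_pos _).le)
    (Measurable.aestronglyMeasurable (hS.ennreal_toReal.neg.const_mul t).exp)

/-- The moments of an exponentially tilted nonnegative random variable, from the derivatives of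
its Laplace transform. -/
theorem integral_pow_mul_exp_of_laplace [IsFiniteMeasure P] (hS : Measurable S) {L : ℝ → ℝ}
    (hL : ∀ t, 0 < t → (∫⁻ ω, expNeg (ENNReal.ofReal t * S ω) ∂P).toReal = L t)
    {s : ℝ} (hs : 0 < s) (i : ℕ) :
    ∫ ω in {ω | S ω ≠ ∞}, (-(S ω).toReal) ^ i * Real.exp (s * -(S ω).toReal) ∂P
      = iteratedDeriv i L s := by
  have hmem : s ∈ interior (integrableExpSet (fun ω => -(S ω).toReal)
      (P.restrict {ω | S ω ≠ ∞})) :=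
    mem_interior.2 ⟨_, Ioi_subset_integrableExpSet hS, isOpen_Ioi, hs⟩
  rw [← iteratedDeriv_mgf hmem i]
  refine Filter.EventuallyEq.iteratedDeriv_eq i ?_
  filter_upwards [Ioi_mem_nhds hs] with t ht
  rw [mgf_neg_toReal_restrict hS ht, hL t ht]

theorem integrable_pow_mul_exp_neg [IsFiniteMeasure P] (hS : Measurable S) {s : ℝ}
    (hs : 0 < s) (i : ℕ) :
    Integrable (fun ω => (-(S ω).toReal) ^ i * Real.exp (s * -(S ω).toReal)) P :=
  integrable_pow_mul_exp_of_mem_interior_integrableExpSet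
    (mem_interior.2 ⟨_, Ioi_subset_integrableExpSet hS, isOpen_Ioi, hs⟩) i

/-- The probability that a nonnegative random variable with an Erlang tail exceeds an independent
random variable, in terms of the Laplace transform of the latter. -/
theorem measureReal_lt_of_erlang_tail [IsProbabilityMeasure P] (hS : Measurable S) {Q : Ω → ℝ}
    (hQ : Measurable Q) (hind : IndepFun S Q P) {L : ℝ → ℝ}
    (hL : ∀ t, 0 < t → (∫⁻ ω, expNeg (ENNReal.ofReal t * S ω) ∂P).toReal = L t)
    {c s : ℝ} (hc : 0 < c) (hs : 0 < s) (k : ℕ)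
    (htail : ∀ q : ℝ, 0 ≤ q → P {ω | c * q < Q ω} = ENNReal.ofReal (Real.exp (-(s * q)) *
      ∑ i ∈ Finset.range k, (s * q) ^ i / (i.factorial : ℝ))) :
    P.real {ω | ENNReal.ofReal c * S ω < ENNReal.ofReal (Q ω)}
      = ∑ i ∈ Finset.range k, (-s) ^ i / (i.factorial : ℝ) * iteratedDeriv i L s := by
  have hprod := (indepFun_iff_map_prod_eq_prod_map_map hS.aemeasurable hQ.aemeasurable).1 hind
  have : IsProbabilityMeasure (P.map Q) := Measure.isProbabilityMeasure_map hQ.aemeasurable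
  have hA : MeasurableSet {p : ℝ≥0∞ × ℝ | ENNReal.ofReal c * p.1 < ENNReal.ofReal p.2} :=
    measurableSet_lt (by fun_prop) (by fun_prop)
  have hfail : P {ω | ENNReal.ofReal c * S ω < ENNReal.ofReal (Q ω)}
      = ∫⁻ ω in {ω | S ω ≠ ∞}, ENNReal.ofReal (∑ i ∈ Finset.range k,
          (-s) ^ i / (i.factorial : ℝ) *
            ((-(S ω).toReal) ^ i * Real.exp (s * -(S ω).toReal))) ∂P := by
    calc P {ω | ENNReal.ofReal c * S ω < ENNReal.ofReal (Q ω)}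
        = (P.map fun ω => (S ω, Q ω))
            {p : ℝ≥0∞ × ℝ | ENNReal.ofReal c * p.1 < ENNReal.ofReal p.2} :=
          (Measure.map_apply (hS.prodMk hQ) hA).symm
      _ = ∫⁻ ω, (P.map Q) {q | ENNReal.ofReal c * S ω < ENNReal.ofReal q} ∂P := by
          rw [hprod, Measure.prod_apply hA]
          exact lintegral_map (measurable_measure_prodMk_left hA) hS
      _ = _ := by
          rw [← lintegral_indicator (measurableSet_ne_top hS)]
          refine lintegral_congr fun ω => ?_
          by_cases hω : S ω = ∞
          -- An infinite supply never falls short of the finite demand.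
          · rw [Set.indicator_of_notMem (by simpa using hω), hω,
              ENNReal.mul_top (by simpa using hc)]
            simp
          · rw [Set.indicator_of_mem (by simpa using hω), Measure.map_apply hQ
              (measurableSet_lt measurable_const (by fun_prop))]
            have hset : Q ⁻¹' {q | ENNReal.ofReal c * S ω < ENNReal.ofReal q}
                = {ω' | c * (S ω).toReal < Q ω'} := by
              ext ω'
              simp only [Set.mem_preimage, Set.mem_ofPred_eq]
              nth_rewrite 1 [← ENNReal.ofReal_toReal hω]
              rw [← ENNReal.ofReal_mul hc.le,
                ENNReal.ofReal_lt_ofReal_iff_of_nonneg (by positivity)]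
            rw [hset, htail _ ENNReal.toReal_nonneg, Finset.mul_sum]
            congr 1
            refine Finset.sum_congr rfl fun i _ => ?_
            -- Both signs are flipped so that powers of `-S` appear, as in the derivatives of `L`.
            rw [show s * (S ω).toReal = -s * -(S ω).toReal by ring, mul_pow,
              show -(-s * -(S ω).toReal) = s * -(S ω).toReal by ring]
            ring
  have hint : ∀ i ∈ Finset.range k, Integrable (fun ω => (-s) ^ i / (i.factorial : ℝ) *
      ((-(S ω).toReal) ^ i * Real.exp (s * -(S ω).toReal))) (P.restrict {ω | S ω ≠ ∞}) :=
    fun i _ => (integrable_pow_mul_exp_neg hS hs i).const_mul _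
  have hnn : ∀ ω, 0 ≤ ∑ i ∈ Finset.range k, (-s) ^ i / (i.factorial : ℝ) *
      ((-(S ω).toReal) ^ i * Real.exp (s * -(S ω).toReal)) := by
    intro ω
    refine Finset.sum_nonneg fun i _ => ?_
    rw [← mul_assoc, div_mul_eq_mul_div, ← mul_pow, neg_mul_neg]
    positivity
  rw [measureReal_def, hfail, ← ofReal_integral_eq_lintegral_ofReal
    (integrable_finsetSum _ hint) (ae_of_all _ hnn), ENNReal.toReal_ofReal (integral_nonneg hnn),
    integral_finsetSum _ hint]
  refine Finset.sum_congr rfl fun i _ => ?_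
  rw [integral_const_mul, integral_pow_mul_exp_of_laplace hS hL hs i]

end Laplace

theorem energySupplyProb_harvestedEnergy {Ω : Type*} [MeasurableSpace Ω] {P : Measure Ω}
    [IsProbabilityMeasure P] {m k n : ℕ} (hm : 0 < m) (hn : n = 2 * k) {lam η Pt PPB mu : ℝ}
    (hlam : 0 ≤ lam) (hη : 2 < η) (hPt : 0 < Pt) (hPPB : 0 < PPB) (hmu : 0 < mu)
    {x : ℕ → Ω → Plane} {H : ℕ → Ω → ℝ} {X : Fin n → Ω → ℝ}
    (hmodel : IsMultiBeaconNetwork P lam Pt x H X) {s : ℝ}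
    (hs : s = m * (PPB * mu) / (2 * Pt)) :
    energySupplyProb P m X (harvestedEnergy PPB mu η x H) =
      1 - Real.exp (logLaplace lam η s) * ∑ i ∈ Finset.range k, (-s) ^ i / (i.factorial : ℝ) *
          completeBell i (fun j => logLaplaceDeriv lam η j s) := by
  set S : Ω → ℝ≥0∞ := fun ω => shotNoise η (fun k => x k ω) fun k => H k ω with hSdef
  set Q : Ω → ℝ := fun ω => ∑ i, X i ω ^ 2 with hQdef
  have hm0 : (0 : ℝ) < m := by exact_mod_cast hm
  have hc : 0 < m * (PPB * mu) := by positivity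
  have hs0 : 0 < s := by rw [hs]; positivity
  have hS : Measurable S := (measurable_shotNoise η).comp
    ((measurable_pi_lambda _ hmodel.ppp.measurable).prodMk
      (measurable_pi_lambda _ hmodel.measurable_H))
  have hsq : Measurable fun u : Fin n → ℝ => ∑ i, u i ^ 2 := by fun_prop
  have hQ : Measurable Q := hsq.comp (measurable_pi_lambda _ hmodel.measurable_X)
  have hind : IndepFun S Q P := (hmodel.indep_X_xH.comp hsq (measurable_shotNoise η)).symm
  have hv : Pt.toNNReal ≠ 0 := (Real.toNNReal_pos.2 hPt).ne'
  have hL : ∀ t, 0 < t → (∫⁻ ω, expNeg (ENNReal.ofReal t * S ω) ∂P).toReal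
      = Real.exp (logLaplace lam η t) := fun t ht => by
    rw [hSdef, lintegral_expNeg_shotNoise hmodel.ppp hlam hη hmodel.measurable_H
      hmodel.hasLaw_H hmodel.indep_H hmodel.indep_x_H ht, ENNReal.toReal_ofReal (Real.exp_pos _).le]
  have htail : ∀ q : ℝ, 0 ≤ q → P {ω | m * (PPB * mu) * q < Q ω} = ENNReal.ofReal
      (Real.exp (-(s * q)) * ∑ i ∈ Finset.range k, (s * q) ^ i / (i.factorial : ℝ)) := by
    intro q hq
    have h := measure_lt_sum_sq_gaussian hv k (by simpa using hn) hmodel.measurable_X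
      hmodel.hasLaw_X hmodel.indep_X (q := m * (PPB * mu) * q) (by positivity)
    rw [Real.coe_toNNReal _ hPt.le, mul_div_right_comm, ← hs] at h
    exact h
  have hfail := measureReal_lt_of_erlang_tail hS hQ hind hL hc hs0 k htail
  -- The transmit energy is compared with `c S`, where `c = m (PPB * mu)`; the Erlang rate `1/(2
  -- Pt)` times `c` is `s`.
  have hset : {ω | ENNReal.ofReal (∑ i, X i ω ^ 2) ≤ (m : ℝ≥0∞) * harvestedEnergy PPB mu η x H ω}
      = {ω | ENNReal.ofReal (m * (PPB * mu)) * S ω < ENNReal.ofReal (Q ω)}ᶜ := by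
    ext ω
    rw [Set.mem_compl_iff, Set.mem_ofPred_eq, Set.mem_ofPred_eq, not_lt,
      ENNReal.ofReal_mul hm0.le, ENNReal.ofReal_natCast, mul_assoc]
    rfl
  have hmeas : MeasurableSet {ω | ENNReal.ofReal (m * (PPB * mu)) * S ω < ENNReal.ofReal (Q ω)} :=
    measurableSet_lt (hS.const_mul _) hQ.ennreal_ofReal
  rw [energySupplyProb, hset, probReal_compl_eq_one_sub hmeas, hfail, Finset.mul_sum]
  congr 1
  refine Finset.sum_congr rfl fun i _ => ?_
  rw [iteratedDeriv_exp_logLaplace hη lam hs0 i]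
  ring

end EnergyHarvesting

open EnergyHarvesting in
theorem proposition4 {Ω : Type*} [MeasurableSpace Ω] (P : Measure Ω) [IsProbabilityMeasure P]
    (m n : ℕ) (hm : 0 < m) (hn : Even n)
    (lam η Pt PPB mu : ℝ) (hlam : 0 < lam) (hη : 2 < η) (hPt : 0 < Pt) (hPPB : 0 < PPB)
    (hmu : 0 < mu)
    (x : ℕ → Ω → Plane) (H : ℕ → Ω → ℝ) (X : Fin n → Ω → ℝ)
    (hmodel : IsMultiBeaconNetwork P lam Pt x H X)
    (a s : ℝ) (ha : a = Pt / (mu * PPB)) (hs : s = (m : ℝ) / (2 * a)) :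
    (energySupplyProb P m X (harvestedEnergy PPB mu η x H) =
      1 - Real.exp (-(Real.pi * lam) * (s / (1 + s) + hypF 0 s η)) *
        ∑ i ∈ Finset.range (n / 2), (-s) ^ i / (i.factorial : ℝ) *
          completeBell i (fun j => logLaplaceDeriv lam η j s)) ∧
    (∀ y : ℝ, 0 < y → ContDiffAt ℝ (⊤ : ℕ∞) (logLaplace lam η) y ∧
      ∀ i : ℕ, 1 ≤ i → iteratedDeriv i (logLaplace lam η) y = logLaplaceDeriv lam η i y) ∧
    (∀ y : ℝ, 0 < y → ∀ k : ℕ,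
      iteratedDeriv k (fun t => gaussHypergeometric 1 (1 - 2 / η) (2 - 2 / η) (-t)) y =
        upsilon k η *
          gaussHypergeometric (k + 1) (k + 1 - 2 / η) (k + 2 - 2 / η) (-y)) := by
  refine ⟨?_, fun y hy => ⟨contDiffAt_logLaplace hη lam hy _, fun i hi =>
    iteratedDeriv_logLaplace hη lam hy hi⟩, fun y hy k =>
    iteratedDeriv_gaussHypergeometric_neg hη k hy⟩
  refine energySupplyProb_harvestedEnergy hm (by obtain ⟨r, rfl⟩ := hn; omega) hlam.le hη hPt hPPB
    hmu hmodel ?_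
  rw [hs, ha]
  field_simp
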